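/- Conventions. For $f\in L_2(\mathbb R)$ the Fourier transform is $F(x)=\frac1{\sqrt{2\pi}}\int_{-\infty}^{\infty}f(t)e^{ixt}\,dt$ and the inverse transform is $f(t)=\frac1{\sqrt{2\pi}}\int_{-\infty}^{\infty}F(x)e^{-ixt}\,dx$, both in the sense of Plancherel. Let $\{\!\{0\}\!\}$ be the set of all $F:\mathbb R\to\mathbb C$ in $L_2(\mathbb R)$ that are Hölder continuous on $\mathbb R$, that is $|F(x)-F(y)|\le C|x-y|^{r}$ for all $x,y\in\mathbb R$, with some $C\ge 0$ and $0<r\le 1$. Let $\{\!\{0,\infty\}\!\}$ (respectively $\{\!\{-\infty,0\}\!\}$) be the set of those $F\in\{\!\{0\}\!\}$ whose inverse Fourier transform vanishes almost everywhere on $(-\infty,0)$ (respectively on $(0,\infty)$). The index of a continuous zero-free $K:\mathbb R\to\mathbb C$ is $\frac1{2\pi}\bigl(\lim_{t\to+\infty}\arg K(t)-\lim_{t\to-\infty}\arg K(t)\bigr)$, for a continuous branch of $\arg K$ on $\mathbb R$. A Riemann–Hilbert factorisation of $K:\mathbb R\to\mathbb C$ is a pair of functions $K^{+}$, $K^{-}$,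 analytic and zero-free in the open upper and the open lower half-plane respectively, which have boundary values $K^{\pm}(x)=\lim_{z\to x}K^{\pm}(z)$ ($z$ in the respective half-plane) at every $x\in\mathbb R$, such that $K^{+}-1\in\{\!\{0,\infty\}\!\}$ and $K^{-}-1\in\{\!\{-\infty,0\}\!\}$ on $\mathbb R$, and $$K(x)=K^{+}(x)K^{-}(x)\qquad\text{for all }x\in\mathbb R.$$ Theorem. Let $K:\mathbb R\to\mathbb C$ be zero-free, with $K-1\in\{\!\{0\}\!\}$ and index $0$. Then there is exactly one continuous function $\ln K:\mathbb R\to\mathbb C$ with $\exp(\ln K)=K$ that tends to $0$ at $\pm\infty$, and it belongs to $L_2(\mathbb R)$. Let $\kappa\in L_2(\mathbb R)$ be the inverse Fourier transform of $\ln K$. Then the functions $$K^{+}(z)=\exp\Bigl(\frac1{\sqrt{2\pi}}\int_0^{\infty}\kappa(t)e^{izt}\,dt\Bigr)\ (\operatorname{Im}z>0),\qquad K^{-}(z)=\exp\Bigl(\frac1{\sqrt{2\pi}}\int_{-\infty}^{0}\kappa(t)e^{izt}\,dt\Bigr)\ (\operatorname{Im}z<0),$$ where both integrals converge absolutely, form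 a Riemann–Hilbert factorisation of $K$, and it is the only one. -/

import Mathlib

open MeasureTheory Filter Topology
open scoped FourierTransform NNReal

noncomputable section

namespace RiemannHilbert

/-- The class `L₂(ℝ) ∩ Hölder` of complex functions on the real line. -/
def MemL2Holder (F : ℝ → ℂ) : Prop :=
  MemLp F 2 volume ∧ ∃ C r : ℝ≥0, 0 < r ∧ r ≤ 1 ∧ HolderWith C r F

/-- The inverse Fourier transform `f(t) = (2π)^(-1/2) ∫ F(x) e^(-ixt) dx` on `L₂(ℝ)`, in the sense
of Plancherel (a representative of the `L₂` class). Mathlib's `𝓕` is the continuous extension to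
`L₂` of `F ↦ (ξ ↦ ∫ F(x) e^(-2πixξ) dx)`, so one takes `ξ = t / (2π)` and rescales. -/
def invFourier (F : ℝ → ℂ) (hF : MemLp F 2 volume) : ℝ → ℂ := fun t =>
  ((Real.sqrt (2 * Real.pi))⁻¹ : ℂ) * (𝓕 (hF.toLp F) : Lp ℂ 2 (volume : Measure ℝ)) (t / (2 * Real.pi))

/-- The class of the functions in `L₂ ∩ Hölder` whose inverse Fourier transform lives on the
positive half-line. -/
def MemPlus (F : ℝ → ℂ) : Prop :=
  MemL2Holder F ∧ ∃ hF : MemLp F 2 volume, ∀ᵐ t : ℝ, t < 0 → invFourier F hF t = 0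

/-- The class of the functions in `L₂ ∩ Hölder` whose inverse Fourier transform lives on the
negative half-line. -/
def MemMinus (F : ℝ → ℂ) : Prop :=
  MemL2Holder F ∧ ∃ hF : MemLp F 2 volume, ∀ᵐ t : ℝ, 0 < t → invFourier F hF t = 0

/-- `K` has index `n`: for a continuous branch `θ` of the argument along the real line,
`n = (1/2π) (lim_{t → +∞} θ t - lim_{t → -∞} θ t)`, both limits being finite. -/
def HasIndex (K : ℝ → ℂ) (n : ℝ) : Prop :=
  ∃ θ : ℝ → ℝ, Continuous θ ∧ (∀ x, K x = (‖K x‖ : ℂ) * Complex.exp (Complex.I * (θ x : ℂ))) ∧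
    ∃ a b : ℝ, Tendsto θ atTop (𝓝 a) ∧ Tendsto θ atBot (𝓝 b) ∧ n = (a - b) / (2 * Real.pi)

/-- `L` is the single-valued logarithm of `K` on the real line: a continuous branch that vanishes
at `±∞`. -/
def IsLn (K L : ℝ → ℂ) : Prop :=
  Continuous L ∧ (∀ x, Complex.exp (L x) = K x) ∧
    Tendsto L atTop (𝓝 0) ∧ Tendsto L atBot (𝓝 0)

/-- The open upper half-plane. -/
def upper : Set ℂ := {z | 0 < z.im}

/-- The open lower half-plane. -/
def lower : Set ℂ := {z | z.im < 0}

/-- `p` is the boundary function on the real line of the function `P` on the open half-plane `S`. -/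
def HasBoundary (S : Set ℂ) (P : ℂ → ℂ) (p : ℝ → ℂ) : Prop :=
  ∀ x : ℝ, Tendsto P (𝓝[S] (x : ℂ)) (𝓝 (p x))

/-- A Riemann-Hilbert factorisation `K = K⁺ K⁻` on the real line, with factors that are analytic
and zero-free in the upper and the lower half-plane and normalised to be `1` at infinity: the
boundary functions minus `1` belong to the one-sided classes. Only the values of `P` in the upper
and of `Q` in the lower half-plane matter. -/
structure IsFactorisation (K : ℝ → ℂ) (P Q : ℂ → ℂ) : Prop where
  analytic_plus : AnalyticOnNhd ℂ P upper
  analytic_minus : AnalyticOnNhd ℂ Q lower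
  ne_zero_plus : ∀ z ∈ upper, P z ≠ 0
  ne_zero_minus : ∀ z ∈ lower, Q z ≠ 0
  boundary : ∃ p q : ℝ → ℂ, HasBoundary upper P p ∧ HasBoundary lower Q q ∧
    MemPlus (fun x => p x - 1) ∧ MemMinus (fun x => q x - 1) ∧ ∀ x, K x = p x * q x

/-- `exp ((2π)^(-1/2) ∫_0^∞ κ(t) e^(izt) dt)`. -/
def factorPlus (κ : ℝ → ℂ) (z : ℂ) : ℂ :=
  Complex.exp (((Real.sqrt (2 * Real.pi))⁻¹ : ℂ) *
    ∫ t in Set.Ioi (0 : ℝ), κ t * Complex.exp (Complex.I * z * (t : ℂ)))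

/-- `exp ((2π)^(-1/2) ∫_{-∞}^0 κ(t) e^(izt) dt)`. -/
def factorMinus (κ : ℝ → ℂ) (z : ℂ) : ℂ :=
  Complex.exp (((Real.sqrt (2 * Real.pi))⁻¹ : ℂ) *
    ∫ t in Set.Iio (0 : ℝ), κ t * Complex.exp (Complex.I * z * (t : ℂ)))

end RiemannHilbert

end

namespace RiemannHilbert

/-! Everything is carried by the Cauchy integral `cauchy L` of the logarithm `L` of `K`. The Cauchy
kernel is, up to a constant, the inverse Fourier transform of an exponential on a half-line. By
Plancherel the exponents in `factorPlus` and `factorMinus` are therefore `cauchy L` and `-cauchy L`,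
and an `L²` function has one-sided spectrum exactly when its Cauchy integral vanishes in a
half-plane (`cauchy_eq_zero_iff`).

Existence: `L` inherits square integrability and Hölder continuity from `K - 1`
(`IsLn.memL2Holder`). Privalov's estimate and the jump estimate yield boundary values `c` of `cauchy
L` from above and `L - c` of `-cauchy L` from below, with spectra on opposite half-lines
(`exists_additive_splitting`). One-sidedness survives products, hence the exponential series
(`cauchy_exp_sub_one_eq_zero`), so `exp c` and `exp (L - c)` are admissible boundary functions with
product `K`.

Uniqueness: for a factorisation `P`, `Q` the functions `P * exp (-cauchy L)` above and `exp (-cauchy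
L) / Q` below agree on the real line and glue to an entire function by Morera. No growth of `P` or
`Q` is assumed, but each is determined by its boundary function through a Cauchy integral, so both
tend to `1` at infinity; Liouville then makes the glued function `1`. -/

/-! ### Inverse Fourier transforms on `L¹` and `L²`. -/

theorem integral_mul_fourierInv_eq_flip {φ h : ℝ → ℂ} (hφ : Integrable φ) (hh : Integrable h) :
    ∫ x, φ x * 𝓕⁻ h x = ∫ x, 𝓕⁻ φ x * h x := by
  have := VectorFourier.integral_fourierIntegral_smul_eq_flip (μ := volume) (ν := volume)
    (L := -innerₗ ℝ) (f := φ) (g := h) Real.continuous_fourierChar (by fun_prop) hφ hh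
  simp only [smul_eq_mul] at this
  have h2 : (-innerₗ ℝ : ℝ →ₗ[ℝ] ℝ →ₗ[ℝ] ℝ).flip = -innerₗ ℝ := by
    ext; simp
  rw [h2] at this
  exact this.symm

theorem continuous_fourierInv {h : ℝ → ℂ} (hh : Integrable h) : Continuous (𝓕⁻ h) :=
  VectorFourier.fourierIntegral_continuous Real.continuous_fourierChar
    (L := -innerₗ ℝ) (by fun_prop) hh

theorem ae_eq_of_forall_schwartz {u v : ℝ → ℂ} (hu : LocallyIntegrable u)
    (hv : LocallyIntegrable v)
    (h : ∀ φ : SchwartzMap ℝ ℂ, ∫ x, φ x * u x = ∫ x, φ x * v x) : u =ᵐ[volume] v := by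
  refine ae_eq_of_integral_contDiff_smul_eq hu hv fun g hg hgc => ?_
  have hg₁ : HasCompactSupport (Complex.ofRealCLM ∘ g) := hgc.comp_left rfl
  have hg₂ : ContDiff ℝ (↑(⊤ : ℕ∞)) (Complex.ofRealCLM ∘ g) := by fun_prop
  simpa using h (hg₁.toSchwartzMap hg₂)

/-- The inverse Fourier transform on `L²` moves to a Schwartz test function. -/
theorem integral_schwartz_mul_fourierInv (φ : SchwartzMap ℝ ℂ) (v : Lp ℂ 2 (volume : Measure ℝ)) :
    ∫ x, φ x * (𝓕⁻ v : Lp ℂ 2 (volume : Measure ℝ)) x = ∫ x, (𝓕⁻ (φ : ℝ → ℂ)) x * v x := by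
  have := congrArg (fun T => T φ) (Lp.fourierInv_toTemperedDistribution_eq v)
  simp only [TemperedDistribution.fourierInv_apply, Lp.toTemperedDistribution_apply, smul_eq_mul,
    SchwartzMap.fourierInv_coe] at this
  exact this.symm

theorem locallyIntegrable_Lp (v : Lp ℂ 2 (volume : Measure ℝ)) : LocallyIntegrable v :=
  (Lp.memLp v).locallyIntegrable (by norm_num)

/-- On `L¹ ∩ L²` the inverse Fourier transform of `L²` is given by the integral. -/
theorem fourierInv_toLp_ae_eq {h : ℝ → ℂ} (h1 : Integrable h) (h2 : MemLp h 2) :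
    (𝓕⁻ (h2.toLp h) : Lp ℂ 2 (volume : Measure ℝ)) =ᵐ[volume] 𝓕⁻ h := by
  refine ae_eq_of_forall_schwartz (locallyIntegrable_Lp _)
    (continuous_fourierInv h1).locallyIntegrable fun φ => ?_
  rw [integral_schwartz_mul_fourierInv, integral_mul_fourierInv_eq_flip φ.integrable h1]
  refine integral_congr_ae ?_
  filter_upwards [h2.coeFn_toLp] with x hx
  rw [hx]

/-- Every Schwartz function is an inverse transform, so moving that transform onto `u` makes all
pairings vanish. -/
theorem ae_eq_zero_of_fourierInv_eq_zero {u : ℝ → ℂ} (hu : Integrable u)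
    (h : ∀ x, 𝓕⁻ u x = 0) : u =ᵐ[volume] 0 := by
  refine ae_eq_of_forall_schwartz hu.locallyIntegrable
    (locallyIntegrable_const (0 : ℂ)) fun φ => ?_
  have h3 := integral_mul_fourierInv_eq_flip (𝓕 φ : SchwartzMap ℝ ℂ).integrable hu
  have h4 : 𝓕⁻ (⇑(𝓕 φ : SchwartzMap ℝ ℂ)) = φ := by
    rw [← SchwartzMap.fourierInv_coe, FourierTransform.fourierInv_fourier_eq]
  rw [h4] at h3
  simpa [h] using h3.symm

/-! ### One-sided exponentials and the Cauchy kernel. -/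

/-- The exponential `ξ ↦ exp (-2πiwξ)`, cut off to the half-line on which it decays. -/
noncomputable def halfExp (w : ℂ) (ξ : ℝ) : ℂ :=
  if ξ * w.im < 0 then Complex.exp (-2 * Real.pi * Complex.I * w * ξ) else 0

theorem halfExp_eq_indicator_of_pos {w : ℂ} (hw : 0 < w.im) : halfExp w =
    (Set.Iio (0 : ℝ)).indicator fun ξ : ℝ => Complex.exp (-2 * Real.pi * Complex.I * w * ξ) := by
  ext ξ
  simp [halfExp, Set.indicator, mul_neg_iff, hw, not_lt.2 hw.le]

theorem halfExp_eq_indicator_of_neg {w : ℂ} (hw : w.im < 0) : halfExp w =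
    (Set.Ioi (0 : ℝ)).indicator fun ξ : ℝ => Complex.exp (-2 * Real.pi * Complex.I * w * ξ) := by
  ext ξ
  simp [halfExp, Set.indicator, mul_neg_iff, hw, not_lt.2 hw.le]

theorem re_exponent (w : ℂ) : (-2 * Real.pi * Complex.I * w).re = 2 * Real.pi * w.im := by
  simp

theorem integrable_halfExp {w : ℂ} (hw : w.im ≠ 0) : Integrable (halfExp w) := by
  rcases hw.lt_or_gt with hw | hw
  · rw [halfExp_eq_indicator_of_neg hw, integrable_indicator_iff measurableSet_Ioi]
    refine integrableOn_exp_mul_complex_Ioi ?_ 0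
    rw [re_exponent]; nlinarith [Real.pi_pos]
  · rw [halfExp_eq_indicator_of_pos hw, integrable_indicator_iff measurableSet_Iio]
    refine (integrableOn_exp_mul_complex_Iic ?_ 0).mono_set Set.Iio_subset_Iic_self
    rw [re_exponent]; positivity

/-- The squared norm of `halfExp w` is the norm of `halfExp (2 * w)`, which is integrable. -/
theorem memLp_halfExp {w : ℂ} (hw : w.im ≠ 0) : MemLp (halfExp w) 2 := by
  rw [memLp_two_iff_integrable_sq_norm (integrable_halfExp hw).aestronglyMeasurable]
  have h : (2 * w).im ≠ 0 := by simpa using hw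
  refine (integrable_halfExp h).norm.congr (Eventually.of_forall fun ξ => ?_)
  have h2 : ξ * (2 * w).im < 0 ↔ ξ * w.im < 0 := by
    simp only [Complex.mul_im, Complex.re_ofNat, Complex.im_ofNat]
    constructor <;> intro <;> linarith
  simp only [halfExp, h2]
  split_ifs
  · rw [← norm_pow, ← Complex.exp_nat_mul]; congr 2; push_cast; ring
  · simp

theorem fourierInv_halfExp {w : ℂ} (hw : w.im ≠ 0) (x : ℝ) :
    𝓕⁻ (halfExp w) x = Real.sign w.im * ((2 * Real.pi * Complex.I)⁻¹ * (x - w)⁻¹) := by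
  have hxw : (x : ℂ) - w ≠ 0 := fun h => hw (by simpa using congrArg Complex.im h)
  have key : ∀ ξ : ℝ, Complex.exp (↑(2 * Real.pi * inner ℝ ξ x) * Complex.I) •
      Complex.exp (-2 * Real.pi * Complex.I * w * ξ) =
      Complex.exp (2 * Real.pi * Complex.I * (x - w) * ξ) := fun ξ => by
    rw [smul_eq_mul, ← Complex.exp_add]; congr 1; simp; ring
  have hre : (2 * Real.pi * Complex.I * (x - w)).re = 2 * Real.pi * w.im := by
    simp
  rw [Real.fourierInv_eq']
  rcases hw.lt_or_gt with hw | hw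
  · have : ∀ ξ : ℝ, Complex.exp (↑(2 * Real.pi * inner ℝ ξ x) * Complex.I) • halfExp w ξ =
        (Set.Ioi (0 : ℝ)).indicator
          (fun ξ : ℝ => Complex.exp (2 * Real.pi * Complex.I * (x - w) * ξ)) ξ := fun ξ => by
      rw [halfExp_eq_indicator_of_neg hw]
      by_cases h : ξ ∈ Set.Ioi (0 : ℝ)
      · simp only [Set.indicator_of_mem h, key]
      · simp only [Set.indicator_of_notMem h, smul_zero]
    simp_rw [this]
    rw [integral_indicator measurableSet_Ioi, integral_exp_mul_complex_Ioi, Real.sign_of_neg hw]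
    · simp only [Complex.ofReal_zero, mul_zero, Complex.exp_zero]; push_cast; field_simp
    · rw [hre]; nlinarith [Real.pi_pos]
  · have : ∀ ξ : ℝ, Complex.exp (↑(2 * Real.pi * inner ℝ ξ x) * Complex.I) • halfExp w ξ =
        (Set.Iio (0 : ℝ)).indicator
          (fun ξ : ℝ => Complex.exp (2 * Real.pi * Complex.I * (x - w) * ξ)) ξ := fun ξ => by
      rw [halfExp_eq_indicator_of_pos hw]
      by_cases h : ξ ∈ Set.Iio (0 : ℝ)
      · simp only [Set.indicator_of_mem h, key]
      · simp only [Set.indicator_of_notMem h, smul_zero]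
    simp_rw [this]
    rw [integral_indicator measurableSet_Iio, ← integral_Iic_eq_integral_Iio,
      integral_exp_mul_complex_Iic, Real.sign_of_pos hw]
    · simp; field_simp
    · rw [hre]; positivity

/-- The Cauchy integral of a function on the real line. -/
noncomputable def cauchy (f : ℝ → ℂ) (z : ℂ) : ℂ :=
  (2 * Real.pi * Complex.I)⁻¹ * ∫ x : ℝ, f x * ((x : ℂ) - z)⁻¹

theorem sign_ne_zero {a : ℝ} (ha : a ≠ 0) : (Real.sign a : ℂ) ≠ 0 := by
  rcases Real.sign_apply_eq_of_ne_zero a ha with h | h <;> simp [h]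

theorem sub_ne_zero_of_im_ne_zero {w : ℂ} (hw : w.im ≠ 0) (x : ℝ) : (x : ℂ) - w ≠ 0 :=
  fun h => hw (by simpa using congrArg Complex.im h)

/-- By `fourierInv_halfExp` the kernel is a multiple of the transform of an `L²` function, so
Plancherel replaces an estimate. -/
theorem memLp_kernel {w : ℂ} (hw : w.im ≠ 0) : MemLp (fun x : ℝ => ((x : ℂ) - w)⁻¹) 2 := by
  have h := ((Lp.memLp _).ae_eq
    (fourierInv_toLp_ae_eq (integrable_halfExp hw) (memLp_halfExp hw))).const_mul
    ((Real.sign w.im : ℂ)⁻¹ * (2 * Real.pi * Complex.I))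
  refine h.ae_eq (Eventually.of_forall fun x => ?_)
  have := sign_ne_zero hw
  have := sub_ne_zero_of_im_ne_zero hw x
  simp only [fourierInv_halfExp hw]
  field_simp

theorem integrable_mul_kernel {f : ℝ → ℂ} (hf : MemLp f 2) {z : ℂ} (hz : z.im ≠ 0) :
    Integrable fun x : ℝ => f x * ((x : ℂ) - z)⁻¹ :=
  hf.integrable_mul (memLp_kernel hz)

theorem inner_fourierInv_eq (f g : Lp ℂ 2 (volume : Measure ℝ)) :
    inner ℂ (𝓕⁻ f : Lp ℂ 2 (volume : Measure ℝ)) (𝓕⁻ g) = inner ℂ f g := by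
  rw [← Lp.inner_fourier_eq, FourierTransform.fourier_fourierInv_eq,
    FourierTransform.fourier_fourierInv_eq]

/-- Needed because Plancherel is sesquilinear while the Cauchy integral pairs without conjugation.
-/
theorem conj_halfExp (z : ℂ) (ξ : ℝ) :
    (starRingEnd ℂ) (halfExp ((starRingEnd ℂ) z) ξ) = halfExp z (-ξ) := by
  simp only [halfExp, Complex.conj_im, mul_neg, neg_mul]
  split_ifs
  · rw [← Complex.exp_conj]; congr 1; simp [map_ofNat]
  · simp

/-- Conjugating one kernel turns this into an inner product of transforms of exponentials that live
on opposite half-lines. It allows a constant to be subtracted from `f` in a difference of Cauchy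
integrals. -/
theorem integral_kernel_mul_kernel_eq_zero {z w : ℂ} (hz : 0 < z.im) (hw : 0 < w.im) :
    ∫ x : ℝ, ((x : ℂ) - z)⁻¹ * ((x : ℂ) - w)⁻¹ = 0 := by
  have hz' : ((starRingEnd ℂ) z).im < 0 := by simpa using hz
  set a := (memLp_halfExp hz'.ne).toLp
  set b := (memLp_halfExp hw.ne').toLp
  have h := inner_fourierInv_eq a b
  rw [L2.inner_def, L2.inner_def] at h
  have h0 : ∫ x, inner ℂ (a x) (b x) = 0 := by
    rw [← integral_zero ℝ ℂ]
    refine integral_congr_ae ?_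
    filter_upwards [(memLp_halfExp hz'.ne).coeFn_toLp, (memLp_halfExp hw.ne').coeFn_toLp]
      with x h1 h2
    rw [h1, h2, halfExp, halfExp]
    split_ifs with h3 h4
    · simp only [Complex.conj_im, mul_neg, neg_lt_zero] at h3
      nlinarith [pos_of_mul_pos_left h3 hz.le]
    all_goals simp
  rw [h0] at h
  have h5 : ∀ᵐ x : ℝ, inner ℂ ((𝓕⁻ a : Lp ℂ 2 (volume : Measure ℝ)) x)
      ((𝓕⁻ b : Lp ℂ 2 (volume : Measure ℝ)) x) =
      -((2 * Real.pi)⁻¹ : ℂ) ^ 2 * (((x : ℂ) - z)⁻¹ * ((x : ℂ) - w)⁻¹) := by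
    filter_upwards [fourierInv_toLp_ae_eq (integrable_halfExp hz'.ne) (memLp_halfExp hz'.ne),
      fourierInv_toLp_ae_eq (integrable_halfExp hw.ne') (memLp_halfExp hw.ne')] with x h1 h2
    rw [h1, h2, fourierInv_halfExp hz'.ne, fourierInv_halfExp hw.ne', Real.sign_of_neg hz',
      Real.sign_of_pos hw]
    simp [map_ofNat]
    ring_nf
    simp
    ring
  rw [integral_congr_ae h5, integral_const_mul] at h
  exact (mul_eq_zero.1 h).resolve_left (by simp [Real.pi_ne_zero])

/-- The Cauchy integral is the one-sided Laplace integral of the Fourier transform. -/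
theorem integral_halfExp_mul_fourier {f : ℝ → ℂ} (hf : MemLp f 2) {z : ℂ} (hz : z.im ≠ 0) :
    ∫ ξ, halfExp z (-ξ) * (𝓕 (hf.toLp f) : Lp ℂ 2 (volume : Measure ℝ)) ξ =
      Real.sign z.im * cauchy f z := by
  have hz' : ((starRingEnd ℂ) z).im ≠ 0 := by simpa using hz
  set a := (memLp_halfExp hz').toLp
  have h := Lp.inner_fourier_eq (𝓕⁻ a : Lp ℂ 2 (volume : Measure ℝ)) (hf.toLp f)
  rw [FourierTransform.fourier_fourierInv_eq, L2.inner_def, L2.inner_def] at h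
  calc _ = _ := integral_congr_ae ?_
    _ = _ := h
    _ = _ := integral_congr_ae (g := fun x : ℝ => ((Real.sign z.im : ℂ) *
      (2 * Real.pi * Complex.I)⁻¹) * (f x * ((x : ℂ) - z)⁻¹)) ?_
    _ = _ := by rw [integral_const_mul, cauchy, mul_assoc]
  · filter_upwards [(memLp_halfExp hz').coeFn_toLp] with x h1
    rw [h1, RCLike.inner_apply, conj_halfExp, mul_comm]
  · filter_upwards [fourierInv_toLp_ae_eq (integrable_halfExp hz') (memLp_halfExp hz'),
      hf.coeFn_toLp] with x h1 h2
    rw [h1, h2, fourierInv_halfExp hz']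
    simp only [Complex.conj_im, Real.sign_neg, RCLike.inner_apply]
    simp [map_ofNat]
    ring

theorem integrable_halfExp_neg_mul_fourier (v : Lp ℂ 2 (volume : Measure ℝ)) {z : ℂ}
    (hz : z.im ≠ 0) : Integrable fun ξ => halfExp z (-ξ) * v ξ := by
  refine MemLp.integrable_mul (p := 2) (q := 2) ?_ (Lp.memLp v)
  exact (memLp_halfExp hz).comp_measurePreserving (Measure.measurePreserving_neg volume)

theorem halfExp_add_real (x : ℝ) (z : ℂ) (ξ : ℝ) : halfExp (x + z) (-ξ) =
    Complex.exp (↑(2 * Real.pi * inner ℝ ξ x) * Complex.I) * halfExp z (-ξ) := by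
  simp only [halfExp, Complex.add_im, Complex.ofReal_im, zero_add]
  split_ifs
  · rw [← Complex.exp_add]; congr 1; simp; ring
  · simp

/-- The Cauchy integral on a horizontal line is an inverse Fourier transform. -/
theorem fourierInv_halfExp_mul_fourier {f : ℝ → ℂ} (hf : MemLp f 2) {z : ℂ} (hz : z.im ≠ 0)
    (x : ℝ) : 𝓕⁻ (fun ξ => halfExp z (-ξ) * (𝓕 (hf.toLp f) : Lp ℂ 2 (volume : Measure ℝ)) ξ) x =
      Real.sign z.im * cauchy f (x + z) := by
  have h : ((x : ℂ) + z).im = z.im := by simp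
  rw [Real.fourierInv_eq', ← h, ← integral_halfExp_mul_fourier hf (by rwa [h])]
  refine integral_congr_ae (Eventually.of_forall fun ξ => ?_)
  simp only [smul_eq_mul, halfExp_add_real, mul_assoc]

/-- A one-sided spectrum is the same as a Cauchy integral that vanishes in a half-plane. -/
theorem cauchy_eq_zero_iff {f : ℝ → ℂ} (hf : MemLp f 2) {s : ℝ} (hs : s ≠ 0) :
    (∀ z : ℂ, 0 < s * z.im → cauchy f z = 0) ↔
      ∀ᵐ ξ : ℝ, 0 < s * ξ → (𝓕 (hf.toLp f) : Lp ℂ 2 (volume : Measure ℝ)) ξ = 0 := by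
  constructor
  · intro h
    -- A single horizontal line suffices, at height `s`: there the Cauchy integral is the inverse
    -- transform of the spectrum times an exponential that is nonzero on the half-line in question.
    have hz : ((s : ℂ) * Complex.I).im ≠ 0 := by simpa using hs
    have h1 := ae_eq_zero_of_fourierInv_eq_zero (integrable_halfExp_neg_mul_fourier
      (𝓕 (hf.toLp f) : Lp ℂ 2 (volume : Measure ℝ)) hz) fun x => by
        rw [fourierInv_halfExp_mul_fourier hf hz, h _ (by simpa using hs), mul_zero]
    filter_upwards [h1] with ξ h2 hξ
    refine (mul_eq_zero.1 h2).resolve_left ?_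
    rw [halfExp, if_pos (by simpa [mul_comm] using hξ)]
    exact Complex.exp_ne_zero _
  · intro h z hz
    have hz' : z.im ≠ 0 := right_ne_zero_of_mul hz.ne'
    have h1 : ∫ ξ, halfExp z (-ξ) * (𝓕 (hf.toLp f) : Lp ℂ 2 (volume : Measure ℝ)) ξ = 0 := by
      rw [← integral_zero ℝ ℂ]
      refine integral_congr_ae ?_
      filter_upwards [h] with ξ hξ
      rw [halfExp]
      split_ifs with h2
      · rw [hξ, mul_zero]
        have h3 : 0 < ξ * z.im := by linarith
        have h4 : 0 < (s * ξ) * z.im ^ 2 := by nlinarith [mul_pos hz h3]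
        exact pos_of_mul_pos_left h4 (sq_nonneg _)
      · simp
    rw [integral_halfExp_mul_fourier hf hz'] at h1
    exact (mul_eq_zero.1 h1).resolve_left (sign_ne_zero hz')

/-! ### The factors and the one-sided classes in terms of Cauchy integrals. -/

theorem indicator_invFourier_mul_exp_pos {f : ℝ → ℂ} (hf : MemLp f 2) {z : ℂ} (hz : 0 < z.im) :
    (Set.Ioi 0).indicator (fun t : ℝ => invFourier f hf t * Complex.exp (Complex.I * z * (t : ℂ))) =
    fun t : ℝ => ((Real.sqrt (2 * Real.pi))⁻¹ : ℂ) * (halfExp z (-(t / (2 * Real.pi))) *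
      (𝓕 (hf.toLp f) : Lp ℂ 2 (volume : Measure ℝ)) (t / (2 * Real.pi))) := by
  ext t
  have h : -(t / (2 * Real.pi)) * z.im < 0 ↔ t ∈ Set.Ioi (0 : ℝ) := by
    rw [neg_mul, neg_lt_zero, mul_pos_iff_of_pos_right hz, div_pos_iff_of_pos_right (by positivity)]
    rfl
  rw [halfExp, Set.indicator]
  simp only [h]
  split_ifs
  · rw [invFourier]
    have : -2 * Real.pi * Complex.I * z * ↑(-(t / (2 * Real.pi))) = Complex.I * z * (t : ℂ) := by
      have := Real.pi_ne_zero
      push_cast; field_simp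
    rw [this]; ring
  · simp

theorem indicator_invFourier_mul_exp_neg {f : ℝ → ℂ} (hf : MemLp f 2) {z : ℂ} (hz : z.im < 0) :
    (Set.Iio 0).indicator (fun t : ℝ => invFourier f hf t * Complex.exp (Complex.I * z * (t : ℂ))) =
    fun t : ℝ => ((Real.sqrt (2 * Real.pi))⁻¹ : ℂ) * (halfExp z (-(t / (2 * Real.pi))) *
      (𝓕 (hf.toLp f) : Lp ℂ 2 (volume : Measure ℝ)) (t / (2 * Real.pi))) := by
  ext t
  have h : -(t / (2 * Real.pi)) * z.im < 0 ↔ t ∈ Set.Iio (0 : ℝ) := by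
    rw [neg_mul, neg_lt_zero, ← neg_mul_neg, mul_pos_iff_of_pos_right (neg_pos.2 hz), neg_pos,
      div_lt_iff₀ (by positivity), zero_mul]
    rfl
  rw [halfExp, Set.indicator]
  simp only [h]
  split_ifs
  · rw [invFourier]
    have : -2 * Real.pi * Complex.I * z * ↑(-(t / (2 * Real.pi))) = Complex.I * z * (t : ℂ) := by
      have := Real.pi_ne_zero
      push_cast; field_simp
    rw [this]; ring
  · simp

/-- The two factors `(2π)^(-1/2)` cancel the Jacobian `2π` of the substitution `t = 2πξ`. -/
theorem integral_rescaled_halfExp {f : ℝ → ℂ} (hf : MemLp f 2) {z : ℂ} (hz : z.im ≠ 0) :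
    Integrable (fun t : ℝ => ((Real.sqrt (2 * Real.pi))⁻¹ : ℂ) * (halfExp z (-(t / (2 * Real.pi))) *
      (𝓕 (hf.toLp f) : Lp ℂ 2 (volume : Measure ℝ)) (t / (2 * Real.pi)))) ∧
    ((Real.sqrt (2 * Real.pi))⁻¹ : ℂ) * ∫ t : ℝ, ((Real.sqrt (2 * Real.pi))⁻¹ : ℂ) *
      (halfExp z (-(t / (2 * Real.pi))) *
      (𝓕 (hf.toLp f) : Lp ℂ 2 (volume : Measure ℝ)) (t / (2 * Real.pi))) =
      Real.sign z.im * cauchy f z := by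
  constructor
  · exact ((integrable_halfExp_neg_mul_fourier _ hz).comp_div (by positivity)).const_mul _
  · rw [integral_const_mul, Measure.integral_comp_div (fun ξ => halfExp z (-ξ) *
      (𝓕 (hf.toLp f) : Lp ℂ 2 (volume : Measure ℝ)) ξ), integral_halfExp_mul_fourier hf hz,
      abs_of_pos (by positivity), Complex.real_smul]
    have h : (Real.sqrt (2 * Real.pi) : ℂ) ^ 2 = ((2 * Real.pi : ℝ) : ℂ) := by
      rw [← Complex.ofReal_pow, Real.sq_sqrt (by positivity)]
    have h0 : (Real.sqrt (2 * Real.pi) : ℂ) ≠ 0 := by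
      have := Real.pi_pos
      exact_mod_cast (by positivity : Real.sqrt (2 * Real.pi) ≠ 0)
    rw [← h]; field_simp

theorem integrableOn_invFourier_pos {f : ℝ → ℂ} (hf : MemLp f 2) {z : ℂ} (hz : 0 < z.im) :
    IntegrableOn (fun t : ℝ => invFourier f hf t * Complex.exp (Complex.I * z * (t : ℂ)))
      (Set.Ioi 0) := by
  rw [← integrable_indicator_iff measurableSet_Ioi, indicator_invFourier_mul_exp_pos hf hz]
  exact (integral_rescaled_halfExp hf hz.ne').1

theorem integrableOn_invFourier_neg {f : ℝ → ℂ} (hf : MemLp f 2) {z : ℂ} (hz : z.im < 0) :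
    IntegrableOn (fun t : ℝ => invFourier f hf t * Complex.exp (Complex.I * z * (t : ℂ)))
      (Set.Iio 0) := by
  rw [← integrable_indicator_iff measurableSet_Iio, indicator_invFourier_mul_exp_neg hf hz]
  exact (integral_rescaled_halfExp hf hz.ne).1

theorem factorPlus_eq {f : ℝ → ℂ} (hf : MemLp f 2) {z : ℂ} (hz : 0 < z.im) :
    factorPlus (invFourier f hf) z = Complex.exp (cauchy f z) := by
  rw [factorPlus, ← integral_indicator measurableSet_Ioi, indicator_invFourier_mul_exp_pos hf hz,
    (integral_rescaled_halfExp hf hz.ne').2, Real.sign_of_pos hz]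
  simp

theorem factorMinus_eq {f : ℝ → ℂ} (hf : MemLp f 2) {z : ℂ} (hz : z.im < 0) :
    factorMinus (invFourier f hf) z = Complex.exp (-cauchy f z) := by
  rw [factorMinus, ← integral_indicator measurableSet_Iio, indicator_invFourier_mul_exp_neg hf hz,
    (integral_rescaled_halfExp hf hz.ne).2, Real.sign_of_neg hz]
  simp

theorem quasiMeasurePreserving_const_mul {a : ℝ} (ha : a ≠ 0) :
    Measure.QuasiMeasurePreserving (fun x : ℝ => a * x) := by
  refine ⟨measurable_const_mul a, ?_⟩
  rw [Real.map_volume_mul_left ha]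
  exact Measure.smul_absolutelyContinuous

theorem ae_invFourier_eq_zero_iff {f : ℝ → ℂ} (hf : MemLp f 2) (s : ℝ) :
    (∀ᵐ t : ℝ, 0 < s * t → invFourier f hf t = 0) ↔
      ∀ᵐ ξ : ℝ, 0 < s * ξ → (𝓕 (hf.toLp f) : Lp ℂ 2 (volume : Measure ℝ)) ξ = 0 := by
  have hpi : (0 : ℝ) < 2 * Real.pi := by positivity
  have h0 : (Real.sqrt (2 * Real.pi) : ℂ) ≠ 0 := by
    exact_mod_cast (Real.sqrt_pos.2 hpi).ne'
  have h1 : ∀ t : ℝ, 0 < s * t ↔ 0 < s * (t / (2 * Real.pi)) := fun t => by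
    rw [← mul_div_assoc, div_pos_iff_of_pos_right hpi]
  simp only [invFourier, mul_eq_zero, inv_eq_zero, h0, false_or]
  constructor
  · intro h
    have := (quasiMeasurePreserving_const_mul hpi.ne').ae h
    filter_upwards [this] with ξ hξ h2
    have h3 : 2 * Real.pi * ξ / (2 * Real.pi) = ξ := by field_simp
    simpa [h3, h1 (2 * Real.pi * ξ), h2] using hξ
  · intro h
    have := (quasiMeasurePreserving_const_mul (inv_ne_zero hpi.ne')).ae h
    filter_upwards [this] with t ht h2
    have h3 : (2 * Real.pi)⁻¹ * t = t / (2 * Real.pi) := by ring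
    rw [h3] at ht
    exact ht ((h1 t).1 h2)

/-- The spectral condition in `MemPlus` is used later only in this form. -/
theorem memPlus_iff {f : ℝ → ℂ} :
    MemPlus f ↔ MemL2Holder f ∧ ∀ z : ℂ, z.im < 0 → cauchy f z = 0 := by
  refine and_congr_right fun hf => ?_
  have h1 := ae_invFourier_eq_zero_iff hf.1 (-1)
  rw [← cauchy_eq_zero_iff hf.1 (by norm_num)] at h1
  simp only [neg_mul, one_mul, Left.neg_pos_iff] at h1
  rw [← h1]
  exact ⟨fun ⟨_, h⟩ => h, fun h => ⟨hf.1, h⟩⟩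

theorem memMinus_iff {f : ℝ → ℂ} :
    MemMinus f ↔ MemL2Holder f ∧ ∀ z : ℂ, 0 < z.im → cauchy f z = 0 := by
  refine and_congr_right fun hf => ?_
  have h1 := ae_invFourier_eq_zero_iff hf.1 1
  rw [← cauchy_eq_zero_iff hf.1 (by norm_num)] at h1
  simp only [one_mul] at h1
  rw [← h1]
  exact ⟨fun ⟨_, h⟩ => h, fun h => ⟨hf.1, h⟩⟩

/-! ### Hölder estimates for the Cauchy integral. -/

theorem integrable_comp_abs {f : ℝ → ℝ} (h : IntegrableOn f (Set.Ioi 0)) :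
    Integrable fun x : ℝ => f |x| := by
  have h1 : IntegrableOn (fun x : ℝ => f |x|) (Set.Ioi 0) :=
    h.congr_fun (fun x (hx : 0 < x) => by simp only [abs_of_pos hx]) measurableSet_Ioi
  have h2 : IntegrableOn (fun x : ℝ => f |x|) (Set.Iio 0) := by
    have h3 : IntegrableOn (fun x : ℝ => f |x|) (Set.Ioi (-0)) := by simpa using h1
    simpa using h3.comp_neg_Iio
  rw [← integrableOn_univ, ← Set.Iic_union_Ioi (a := (0 : ℝ))]
  exact ((integrableOn_Iic_iff_integrableOn_Iio (by simp)).2 h2).union h1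

theorem integrable_abs_rpow_div {r : ℝ} (h0 : 0 < r) (h1 : r < 1) {y : ℝ} (hy : 0 < y) :
    Integrable (fun s : ℝ => |s| ^ (r - 1) / (|s| + y)) ∧
      ∫ s : ℝ, |s| ^ (r - 1) / (|s| + y) =
        y ^ (r - 1) * ∫ s : ℝ, |s| ^ (r - 1) / (|s| + 1) := by
  have hi : Integrable (fun s : ℝ => |s| ^ (r - 1) / (|s| + 1)) := by
    refine integrable_comp_abs (f := fun s : ℝ => s ^ (r - 1) / (s + 1)) ?_
    -- At `x = 1` this integrand is `t^r (1/t - 1/(t + 1)) = t^(r-1) / (t + 1)`.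
    refine (Real.integrableOn_rpowIntegrand₀₁_Ioi (p := r) (x := 1) ⟨h0, h1⟩ zero_le_one).congr_fun
      (fun t (ht : 0 < t) => ?_) measurableSet_Ioi
    simp only [Real.rpowIntegrand₀₁]
    rw [Real.rpow_sub_one ht.ne']
    field_simp
    simp
  have h : ∀ s : ℝ, |s| ^ (r - 1) / (|s| + y) =
      y ^ (r - 1) * y⁻¹ * (|s / y| ^ (r - 1) / (|s / y| + 1)) := fun s => by
    rw [abs_div, abs_of_pos hy, Real.div_rpow (abs_nonneg _) hy.le]
    have := Real.rpow_pos_of_pos hy (r - 1)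
    field_simp
  simp_rw [h]
  refine ⟨(hi.comp_div hy.ne').const_mul _, ?_⟩
  rw [integral_const_mul, Measure.integral_comp_div (fun s : ℝ => |s| ^ (r - 1) / (|s| + 1)),
    abs_of_pos hy, smul_eq_mul]
  field_simp

theorem abs_add_abs_im_le (z : ℂ) (s : ℝ) : |s - z.re| + |z.im| ≤ 2 * ‖(s : ℂ) - z‖ := by
  have h1 := Complex.abs_re_le_norm ((s : ℂ) - z)
  have h2 := Complex.abs_im_le_norm ((s : ℂ) - z)
  simp only [Complex.sub_re, Complex.ofReal_re, Complex.sub_im, Complex.ofReal_im, zero_sub,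
    abs_neg] at h1 h2
  linarith

/-- The Hölder bound cancels part of the singularity at `z.re`. Each kernel costs a factor `2`, and
rescaling by `|z.im|` produces the power `r - 1`. About `w` only the comparison `hw` is needed, so
it may lie in either half-plane. -/
theorem norm_integral_sub_mul_kernel_le {f : ℝ → ℂ} {A r : ℝ} (h0 : 0 < r) (h1 : r < 1)
    (hf : ∀ x y, ‖f x - f y‖ ≤ A * |x - y| ^ r) {z w : ℂ} (hz : z.im ≠ 0)
    (hw : ∀ s : ℝ, |s - z.re| ≤ 2 * ‖(s : ℂ) - w‖) :
    ‖∫ s : ℝ, (f s - f z.re) * (((s : ℂ) - z)⁻¹ * ((s : ℂ) - w)⁻¹)‖ ≤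
      4 * A * (|z.im| ^ (r - 1) * ∫ s : ℝ, |s| ^ (r - 1) / (|s| + 1)) := by
  have hy := abs_pos.2 hz
  obtain ⟨hi, he⟩ := integrable_abs_rpow_div h0 h1 hy
  have ht := integral_sub_right_eq_self (μ := volume)
    (fun s : ℝ => |s| ^ (r - 1) / (|s| + |z.im|)) z.re
  rw [← he, ← ht, ← integral_const_mul]
  refine norm_integral_le_of_norm_le ((hi.comp_sub_right z.re).const_mul (4 * A))
    (Eventually.of_forall fun s => ?_)
  rcases eq_or_ne s z.re with rfl | hs
  -- At the singular point both sides are `0`, because `0 ^ (r - 1) = 0` by convention.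
  · simp [Real.zero_rpow (by linarith : r - 1 ≠ 0)]
  have hu : 0 < |s - z.re| := abs_pos.2 (sub_ne_zero.2 hs)
  have hz2 := abs_add_abs_im_le z s
  have hw2 := hw s
  rw [norm_mul, norm_mul, norm_inv, norm_inv, Real.rpow_sub_one hu.ne']
  have hA : 0 ≤ A * |s - z.re| ^ r := (norm_nonneg _).trans (hf s z.re)
  calc _ ≤ (A * |s - z.re| ^ r) * ((( |s - z.re| + |z.im|) / 2)⁻¹ * (|s - z.re| / 2)⁻¹) := by
        gcongr
        · exact hf _ _
        · linarith
        · linarith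
    _ = _ := by field_simp; ring

theorem integrable_mul_kernel_mul_kernel {f : ℝ → ℂ} (hf : MemLp f 2) {z w : ℂ} (hz : z.im ≠ 0)
    (hw : w.im ≠ 0) : Integrable fun s : ℝ => f s * (((s : ℂ) - z)⁻¹ * ((s : ℂ) - w)⁻¹) := by
  have h := ((integrable_mul_kernel hf hz).sub (integrable_mul_kernel hf hw))
  -- For `z ≠ w` partial fractions reduce to single kernels; for `z = w` one kernel is bounded by
  -- `|z.im|⁻¹`.
  rcases eq_or_ne z w with rfl | hzw
  · refine (integrable_mul_kernel hf hz).mul_bdd (c := |z.im|⁻¹)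
      (memLp_kernel hz).aestronglyMeasurable
      (Eventually.of_forall fun s => ?_) |>.congr (Eventually.of_forall fun s => mul_assoc _ _ _)
    rw [norm_inv]
    exact inv_anti₀ (abs_pos.2 hz) (by simpa using Complex.abs_im_le_norm ((s : ℂ) - z))
  · refine (h.const_mul (z - w)⁻¹).congr (Eventually.of_forall fun s => ?_)
    have := sub_ne_zero_of_im_ne_zero hz s
    have := sub_ne_zero_of_im_ne_zero hw s
    have := sub_ne_zero.2 hzw
    simp only [Pi.sub_apply]
    field_simp
    ring

theorem cauchy_sub_cauchy {f : ℝ → ℂ} (hf : MemLp f 2) {z w : ℂ} (hz : z.im ≠ 0)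
    (hw : w.im ≠ 0) : cauchy f z - cauchy f w = (z - w) * (2 * Real.pi * Complex.I)⁻¹ *
      ∫ s : ℝ, f s * (((s : ℂ) - z)⁻¹ * ((s : ℂ) - w)⁻¹) := by
  rw [cauchy, cauchy, ← mul_sub, ← integral_sub (integrable_mul_kernel hf hz)
    (integrable_mul_kernel hf hw), mul_comm (z - w), mul_assoc _ (z - w), ← integral_const_mul (z - w)]
  congr 2
  ext s
  have := sub_ne_zero_of_im_ne_zero hz s
  have := sub_ne_zero_of_im_ne_zero hw s
  field_simp
  ring

/-- With `c = f z.re` the first integral is small. The second is `0` for two points of the upper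
half-plane and `π / z.im` for conjugate points, which gives continuity and the jump respectively. -/
theorem cauchy_sub_cauchy' {f : ℝ → ℂ} (hf : MemLp f 2) {z w : ℂ} (hz : z.im ≠ 0)
    (hw : w.im ≠ 0) (c : ℂ) : cauchy f z - cauchy f w = (z - w) * (2 * Real.pi * Complex.I)⁻¹ *
      ((∫ s : ℝ, (f s - c) * (((s : ℂ) - z)⁻¹ * ((s : ℂ) - w)⁻¹)) +
        c * ∫ s : ℝ, ((s : ℂ) - z)⁻¹ * ((s : ℂ) - w)⁻¹) := by
  rw [cauchy_sub_cauchy hf hz hw]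
  simp_rw [sub_mul]
  rw [integral_sub (integrable_mul_kernel_mul_kernel hf hz hw), integral_const_mul, sub_add_cancel]
  exact ((memLp_kernel hz).integrable_mul (memLp_kernel hw)).const_mul _

theorem norm_two_pi_I_inv_le : ‖(2 * Real.pi * Complex.I : ℂ)⁻¹‖ ≤ 1 := by
  rw [norm_inv]
  apply inv_le_one_of_one_le₀
  simp [abs_of_pos Real.pi_pos]
  linarith [Real.pi_gt_three]

theorem integral_kernel_mul_kernel_conj {z : ℂ} (hz : 0 < z.im) :
    ∫ s : ℝ, ((s : ℂ) - z)⁻¹ * ((s : ℂ) - (starRingEnd ℂ) z)⁻¹ = (Real.pi / z.im : ℝ) := by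
  have h : ∀ s : ℝ, ((s : ℂ) - z)⁻¹ * ((s : ℂ) - (starRingEnd ℂ) z)⁻¹ =
      ((z.im⁻¹ ^ 2 * (1 + ((s - z.re) / z.im) ^ 2)⁻¹ : ℝ) : ℂ) := fun s => by
    rw [← mul_inv]
    have : ((s : ℂ) - z) * ((s : ℂ) - (starRingEnd ℂ) z) =
        (((s - z.re) ^ 2 + z.im ^ 2 : ℝ) : ℂ) := by
      apply Complex.ext <;> simp [pow_two]; ring
    rw [this, ← Complex.ofReal_inv]
    congr 1
    have : 0 < (s - z.re) ^ 2 + z.im ^ 2 := by positivity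
    field_simp
    ring
  simp_rw [h]
  rw [integral_complex_ofReal, integral_const_mul,
    integral_sub_right_eq_self (fun s : ℝ => (1 + (s / z.im) ^ 2)⁻¹),
    Measure.integral_comp_div (fun s : ℝ => (1 + s ^ 2)⁻¹), integral_univ_inv_one_add_sq,
    abs_of_pos hz]
  congr 1
  simp only [smul_eq_mul]
  field_simp

theorem holder_const_nonneg {f : ℝ → ℂ} {A r : ℝ}
    (hH : ∀ x y, ‖f x - f y‖ ≤ A * |x - y| ^ r) : 0 ≤ A := by
  simpa using (norm_nonneg _).trans (hH 1 0)

theorem integral_abs_rpow_div_nonneg (r : ℝ) : 0 ≤ ∫ s : ℝ, |s| ^ (r - 1) / (|s| + 1) :=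
  integral_nonneg fun s => by positivity

theorem norm_cauchy_sub_le_of_close {f : ℝ → ℂ} {A r : ℝ} (hf : MemLp f 2) (h0 : 0 < r)
    (h1 : r < 1) (hH : ∀ x y, ‖f x - f y‖ ≤ A * |x - y| ^ r) {z w : ℂ} (hz : 0 < z.im)
    (hw : 0 < w.im) (hzw : ∀ s : ℝ, |s - z.re| ≤ 2 * ‖(s : ℂ) - w‖) (hd : ‖z - w‖ ≤ z.im) :
    ‖cauchy f z - cauchy f w‖ ≤
      4 * A * (∫ s : ℝ, |s| ^ (r - 1) / (|s| + 1)) * ‖z - w‖ ^ r := by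
  rcases eq_or_ne z w with rfl | hne
  · simp [Real.zero_rpow h0.ne']
  have hA := holder_const_nonneg hH
  have hM := integral_abs_rpow_div_nonneg r
  have hp : 0 < ‖z - w‖ := norm_pos_iff.2 (sub_ne_zero.2 hne)
  have h := norm_integral_sub_mul_kernel_le h0 h1 hH hz.ne' hzw
  rw [abs_of_pos hz] at h
  rw [cauchy_sub_cauchy' hf hz.ne' hw.ne' (f z.re), integral_kernel_mul_kernel_eq_zero hz hw,
    mul_zero, add_zero, norm_mul, norm_mul]
  -- The exponent `r - 1` is negative, so the smaller base has the larger power.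
  have h2 : z.im ^ (r - 1) ≤ ‖z - w‖ ^ (r - 1) :=
    Real.rpow_le_rpow_of_nonpos hp hd (by linarith)
  calc _ ≤ ‖z - w‖ * 1 * (4 * A * (‖z - w‖ ^ (r - 1) * ∫ s : ℝ, |s| ^ (r - 1) / (|s| + 1))) := by
        gcongr
        · exact norm_two_pi_I_inv_le
        · exact h.trans (by gcongr)
    _ = _ := by rw [Real.rpow_sub_one hp.ne']; field_simp

theorem norm_mk_sub_mk_im (x y y' : ℝ) : ‖(⟨x, y⟩ : ℂ) - ⟨x, y'⟩‖ = |y - y'| := by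
  have : (⟨x, y⟩ : ℂ) - ⟨x, y'⟩ = ((y - y' : ℝ) : ℂ) * Complex.I := by
    apply Complex.ext <;> simp
  rw [this, norm_mul, Complex.norm_I, mul_one, Complex.norm_real, Real.norm_eq_abs]

theorem norm_mk_sub_mk_re (x x' y : ℝ) : ‖(⟨x, y⟩ : ℂ) - ⟨x', y⟩‖ = |x - x'| := by
  have : (⟨x, y⟩ : ℂ) - ⟨x', y⟩ = ((x - x' : ℝ) : ℂ) := by
    apply Complex.ext <;> simp
  rw [this, Complex.norm_real, Real.norm_eq_abs]

/-- **Privalov's theorem**: the Cauchy integral is Hölder continuous in the upper half-plane. -/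
theorem exists_norm_cauchy_sub_le {f : ℝ → ℂ} {A r : ℝ} (hf : MemLp f 2) (h0 : 0 < r)
    (h1 : r < 1) (hH : ∀ x y, ‖f x - f y‖ ≤ A * |x - y| ^ r) :
    ∃ C, 0 ≤ C ∧ ∀ z w : ℂ, 0 < z.im → 0 < w.im →
      ‖cauchy f z - cauchy f w‖ ≤ C * ‖z - w‖ ^ r := by
  set B := 4 * A * (∫ s : ℝ, |s| ^ (r - 1) / (|s| + 1)) with hB
  have hB0 : 0 ≤ B := by
    have hA := holder_const_nonneg hH
    have hM := integral_abs_rpow_div_nonneg r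
    positivity
  have vert' : ∀ x y y' : ℝ, 0 < y' → y' ≤ y →
      ‖cauchy f ⟨x, y⟩ - cauchy f ⟨x, y'⟩‖ ≤ B * |y - y'| ^ r := fun x y y' hy' hy => by
    have := norm_cauchy_sub_le_of_close hf h0 h1 hH (z := ⟨x, y⟩) (w := ⟨x, y'⟩)
      (hy'.trans_le hy) hy' (fun s => ?_) ?_
    · rwa [norm_mk_sub_mk_im] at this
    · have h3 := abs_add_abs_im_le ⟨x, y'⟩ s
      have h4 := abs_nonneg y'
      simp only at h3 ⊢
      linarith
    · rw [norm_mk_sub_mk_im, abs_of_nonneg (by linarith)]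
      simp only
      linarith
  have vert : ∀ x y y' : ℝ, 0 < y → 0 < y' →
      ‖cauchy f ⟨x, y⟩ - cauchy f ⟨x, y'⟩‖ ≤ B * |y - y'| ^ r := fun x y y' hy hy' => by
    rcases le_total y' y with h | h
    · exact vert' x y y' hy' h
    · rw [norm_sub_rev, abs_sub_comm]
      exact vert' x y' y hy h
  have horiz : ∀ x x' y : ℝ, 0 < y → |x - x'| ≤ y →
      ‖cauchy f ⟨x, y⟩ - cauchy f ⟨x', y⟩‖ ≤ B * |x - x'| ^ r := fun x x' y hy hx => by
    have := norm_cauchy_sub_le_of_close hf h0 h1 hH (z := ⟨x, y⟩) (w := ⟨x', y⟩)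
      hy hy (fun s => ?_) ?_
    · rwa [norm_mk_sub_mk_re] at this
    · have h3 := Complex.abs_re_le_norm ((s : ℂ) - ⟨x', y⟩)
      have h4 := Complex.abs_im_le_norm ((s : ℂ) - ⟨x', y⟩)
      simp only [Complex.sub_re, Complex.ofReal_re, Complex.sub_im, Complex.ofReal_im, zero_sub,
        abs_neg, abs_of_pos hy] at h3 h4
      have h5 : |s - x| ≤ |s - x'| + |x' - x| := abs_sub_le _ _ _
      rw [abs_sub_comm x' x] at h5
      simp only
      linarith
    · rwa [norm_mk_sub_mk_re]
  -- Four segments join `z` to `w`: up by `h = ‖z - w‖`, vertically to height `w.im + h`, across,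
  -- and down. Each has length at most `h`, and the crossing takes place at height at least `h`, as
  -- `horiz` requires.
  refine ⟨4 * B, by positivity, fun z w hz hw => ?_⟩
  set h := ‖z - w‖ with hh
  have hh0 : 0 ≤ h := norm_nonneg _
  have hre : |z.re - w.re| ≤ h := by simpa using Complex.abs_re_le_norm (z - w)
  have him : |z.im - w.im| ≤ h := by simpa using Complex.abs_im_le_norm (z - w)
  have mono : ∀ a : ℝ, |a| ≤ h → B * |a| ^ r ≤ B * h ^ r := fun a ha => by gcongr
  have e1 := (vert z.re z.im (z.im + h) hz (by linarith)).trans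
    (mono _ (by rw [abs_of_nonpos (by linarith)]; linarith))
  have e2 := (vert z.re (z.im + h) (w.im + h) (by linarith) (by linarith)).trans
    (mono _ (by rwa [add_sub_add_right_eq_sub]))
  have e3 := (horiz z.re w.re (w.im + h) (by linarith) (by linarith)).trans (mono _ hre)
  have e4 := (vert w.re (w.im + h) w.im (by linarith) hw).trans
    (mono _ (by rw [abs_of_nonneg (by linarith)]; linarith))
  have := norm_sub_le_norm_sub_add_norm_sub (cauchy f z) (cauchy f ⟨z.re, z.im + h⟩) (cauchy f w)
  have := norm_sub_le_norm_sub_add_norm_sub (cauchy f ⟨z.re, z.im + h⟩)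
    (cauchy f ⟨z.re, w.im + h⟩) (cauchy f w)
  have := norm_sub_le_norm_sub_add_norm_sub (cauchy f ⟨z.re, w.im + h⟩)
    (cauchy f ⟨w.re, w.im + h⟩) (cauchy f w)
  simp only [Complex.eta] at e1 e4
  linarith

/-- The jump of the Cauchy integral across the real line. -/
theorem exists_norm_cauchy_jump_le {f : ℝ → ℂ} {A r : ℝ} (hf : MemLp f 2) (h0 : 0 < r)
    (h1 : r < 1) (hH : ∀ x y, ‖f x - f y‖ ≤ A * |x - y| ^ r) :
    ∃ C, ∀ z : ℂ, 0 < z.im →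
      ‖cauchy f z - cauchy f ((starRingEnd ℂ) z) - f z.re‖ ≤ C * z.im ^ r := by
  refine ⟨8 * A * (∫ s : ℝ, |s| ^ (r - 1) / (|s| + 1)), fun z hz => ?_⟩
  have hz' : ((starRingEnd ℂ) z).im ≠ 0 := by simpa using hz.ne'
  have h := norm_integral_sub_mul_kernel_le h0 h1 hH hz.ne' (w := (starRingEnd ℂ) z) fun s => by
    have := abs_add_abs_im_le ((starRingEnd ℂ) z) s
    rw [Complex.conj_re] at this
    linarith [abs_nonneg ((starRingEnd ℂ) z).im]
  have hsub : z - (starRingEnd ℂ) z = 2 * Complex.I * z.im := by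
    apply Complex.ext <;> simp; ring
  rw [abs_of_pos hz] at h
  rw [cauchy_sub_cauchy' hf hz.ne' hz' (f z.re), integral_kernel_mul_kernel_conj hz, mul_add]
  have hzc : (z.im : ℂ) ≠ 0 := by exact_mod_cast hz.ne'
  have hpi : (Real.pi : ℂ) ≠ 0 := by exact_mod_cast Real.pi_ne_zero
  -- The Poisson kernel has total mass one, so the subtracted constant reappears as exactly `f
  -- z.re`.
  have hone : (z - (starRingEnd ℂ) z) * (2 * Real.pi * Complex.I)⁻¹ *
      (f z.re * ((Real.pi / z.im : ℝ) : ℂ)) = f z.re := by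
    rw [hsub]; push_cast; field_simp
  rw [hone, add_sub_cancel_right, norm_mul, norm_mul]
  have hn : ‖z - (starRingEnd ℂ) z‖ = 2 * z.im := by
    rw [hsub]; simp [abs_of_pos hz]
  rw [hn]
  calc _ ≤ 2 * z.im * 1 * (4 * A * (z.im ^ (r - 1) * ∫ s : ℝ, |s| ^ (r - 1) / (|s| + 1))) := by
        gcongr
        exact norm_two_pi_I_inv_le
    _ = _ := by rw [Real.rpow_sub_one hz.ne']; field_simp; ring

/-! ### Boundedness and decay of the Cauchy integral at infinity. -/

theorem norm_halfExp_neg (z : ℂ) (ξ : ℝ) : ‖halfExp z (-ξ)‖ =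
    if 0 < ξ * z.im then Real.exp (-(2 * Real.pi * (ξ * z.im))) else 0 := by
  have : -ξ * z.im < 0 ↔ 0 < ξ * z.im := by rw [neg_mul, neg_lt_zero]
  simp only [halfExp, this]
  split_ifs
  · rw [Complex.norm_exp]; congr 1; simp; ring
  · simp

theorem norm_halfExp_neg_le {z w : ℂ} (hw : 0 < w.im) (h : w.im ≤ z.im) (ξ : ℝ) :
    ‖halfExp z (-ξ)‖ ≤ ‖halfExp w (-ξ)‖ := by
  simp only [norm_halfExp_neg, mul_pos_iff_of_pos_right hw,
    mul_pos_iff_of_pos_right (hw.trans_le h)]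
  split_ifs
  · gcongr
  · rfl

theorem norm_cauchy_le {f : ℝ → ℂ} (hf : MemLp f 2) {z : ℂ} (hz : z.im ≠ 0) : ‖cauchy f z‖ ≤
    ∫ ξ, ‖halfExp z (-ξ) * (𝓕 (hf.toLp f) : Lp ℂ 2 (volume : Measure ℝ)) ξ‖ := by
  have h : ‖cauchy f z‖ = ‖(Real.sign z.im : ℂ) * cauchy f z‖ := by
    rw [norm_mul]
    rcases Real.sign_apply_eq_of_ne_zero _ hz with h | h <;> simp [h]
  rw [h, ← integral_halfExp_mul_fourier hf hz]
  exact norm_integral_le_integral_norm _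

theorem norm_cauchy_le_of_le {f : ℝ → ℂ} (hf : MemLp f 2) {z w : ℂ} (hw : 0 < w.im)
    (h : w.im ≤ z.im) : ‖cauchy f z‖ ≤
    ∫ ξ, ‖halfExp w (-ξ) * (𝓕 (hf.toLp f) : Lp ℂ 2 (volume : Measure ℝ)) ξ‖ := by
  refine (norm_cauchy_le hf (hw.trans_le h).ne').trans ?_
  refine integral_mono (integrable_halfExp_neg_mul_fourier _ (hw.trans_le h).ne').norm
    (integrable_halfExp_neg_mul_fourier _ hw.ne').norm fun ξ => ?_
  simp only [norm_mul]
  gcongr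
  exact norm_halfExp_neg_le hw h ξ

/-- With `norm_cauchy_le_of_le` this gives decay for large `z.im`, uniformly in `z.re`. The
integrand at height one is the dominating function. -/
theorem tendsto_integral_norm_halfExp (v : Lp ℂ 2 (volume : Measure ℝ)) :
    Tendsto (fun y : ℝ => ∫ ξ, ‖halfExp (y * Complex.I) (-ξ) * v ξ‖) atTop (𝓝 0) := by
  rw [← integral_zero ℝ ℝ]
  have hI : (Complex.I).im ≠ 0 := by simp
  refine tendsto_integral_filter_of_dominated_convergence
    (fun ξ => ‖halfExp Complex.I (-ξ) * v ξ‖) ?_ ?_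
    (integrable_halfExp_neg_mul_fourier v hI).norm (Eventually.of_forall fun ξ => ?_)
  · filter_upwards [eventually_gt_atTop 0] with y hy
    exact (integrable_halfExp_neg_mul_fourier v (by simpa using hy.ne')).norm.aestronglyMeasurable
  · filter_upwards [eventually_ge_atTop 1] with y hy
    refine Eventually.of_forall fun ξ => ?_
    rw [norm_norm, norm_mul, norm_mul]
    gcongr
    exact norm_halfExp_neg_le (by simp) (by simpa using hy) ξ
  · simp only [norm_mul, norm_halfExp_neg, Complex.mul_im, Complex.ofReal_re, Complex.I_im,
      mul_one, Complex.ofReal_im, Complex.I_re, mul_zero, add_zero]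
    suffices h : Tendsto (fun y : ℝ => if 0 < ξ * y then Real.exp (-(2 * Real.pi * (ξ * y))) else 0)
        atTop (𝓝 0) by
      have := h.mul_const ‖v ξ‖
      rwa [zero_mul] at this
    rcases le_or_gt ξ 0 with h | h
    · refine tendsto_const_nhds.congr' ?_
      filter_upwards [eventually_gt_atTop 0] with y hy
      rw [if_neg (by nlinarith)]
    · have : Tendsto (fun y : ℝ => Real.exp (-(2 * Real.pi * (ξ * y)))) atTop (𝓝 0) := by
        refine Real.tendsto_exp_neg_atTop_nhds_zero.comp ?_
        exact (tendsto_id.const_mul_atTop h).const_mul_atTop (by positivity)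
      refine this.congr' ?_
      filter_upwards [eventually_gt_atTop 0] with y hy
      rw [if_pos (by positivity)]

/-- Above height one the Laplace integral is bounded; a lower point is compared with the point at
height one on the same vertical line. -/
theorem exists_norm_cauchy_le {f : ℝ → ℂ} {A r : ℝ} (hf : MemLp f 2) (h0 : 0 < r)
    (h1 : r < 1) (hH : ∀ x y, ‖f x - f y‖ ≤ A * |x - y| ^ r) :
    ∃ M, ∀ z : ℂ, 0 < z.im → ‖cauchy f z‖ ≤ M := by
  obtain ⟨C, hC, h⟩ := exists_norm_cauchy_sub_le hf h0 h1 hH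
  refine ⟨C + ∫ ξ, ‖halfExp Complex.I (-ξ) *
    (𝓕 (hf.toLp f) : Lp ℂ 2 (volume : Measure ℝ)) ξ‖, fun z hz => ?_⟩
  rcases le_or_gt 1 z.im with h2 | h2
  · linarith [norm_cauchy_le_of_le hf (z := z) (w := Complex.I) (by simp) (by simpa using h2)]
  · have e1 := norm_cauchy_le_of_le hf (z := ⟨z.re, 1⟩) (w := Complex.I) (by simp) (by simp)
    have e2 := h z ⟨z.re, 1⟩ hz (by simp)
    have e3 : ‖z - ⟨z.re, 1⟩‖ = |z.im - 1| := norm_mk_sub_mk_im z.re z.im 1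
    have e4 : C * |z.im - 1| ^ r ≤ C * 1 := by
      gcongr
      refine Real.rpow_le_one (abs_nonneg _) ?_ h0.le
      rw [abs_le]; constructor <;> linarith
    rw [e3] at e2
    have := norm_le_norm_sub_add (cauchy f z) (cauchy f ⟨z.re, 1⟩)
    linarith

/-- Riemann–Lebesgue, since on a horizontal line the Cauchy integral is the transform of an
integrable function. -/
theorem tendsto_cauchy_horizontal {f : ℝ → ℂ} (hf : MemLp f 2) {y : ℝ} (hy : 0 < y) :
    Tendsto (fun x : ℝ => cauchy f ⟨x, y⟩) (cocompact ℝ) (𝓝 0) := by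
  have hz : ((y : ℂ) * Complex.I).im ≠ 0 := by simpa using hy.ne'
  have h := (Real.zero_at_infty_fourier (fun ξ => halfExp (y * Complex.I) (-ξ) *
    (𝓕 (hf.toLp f) : Lp ℂ 2 (volume : Measure ℝ)) ξ)).comp
    (Homeomorph.neg ℝ).isClosedEmbedding.tendsto_cocompact
  refine h.congr fun x => ?_
  have h2 := fourierInv_halfExp_mul_fourier hf hz x
  rw [Real.fourierInv_eq_fourier_neg] at h2
  simp only [Function.comp, Homeomorph.coe_neg]
  rw [h2]
  have : (x : ℂ) + y * Complex.I = ⟨x, y⟩ := by apply Complex.ext <;> simp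
  simp [this, Real.sign_of_pos hy]

/-- The Cauchy integral vanishes at infinity in the upper half-plane. -/
theorem cauchy_small_upper {f : ℝ → ℂ} {A r : ℝ} (hf : MemLp f 2) (h0 : 0 < r)
    (h1 : r < 1) (hH : ∀ x y, ‖f x - f y‖ ≤ A * |x - y| ^ r) {ε : ℝ} (hε : 0 < ε) :
    ∃ R, ∀ z : ℂ, 0 < z.im → R ≤ ‖z‖ → ‖cauchy f z‖ ≤ ε := by
  obtain ⟨C, hC, h⟩ := exists_norm_cauchy_sub_le hf h0 h1 hH
  obtain ⟨Y, hY0, hY⟩ : ∃ Y : ℝ, 0 < Y ∧ ∀ z : ℂ, Y ≤ z.im → ‖cauchy f z‖ ≤ ε := by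
    obtain ⟨Y, hY⟩ := (((tendsto_integral_norm_halfExp
      (𝓕 (hf.toLp f) : Lp ℂ 2 (volume : Measure ℝ))).eventually_le_const hε).and
      (eventually_gt_atTop 0)).exists
    refine ⟨Y, hY.2, fun z hz => (norm_cauchy_le_of_le hf (w := Y * Complex.I) ?_ ?_).trans hY.1⟩
    · simpa using hY.2
    · simpa using hz
  obtain ⟨η, hη0, hη⟩ : ∃ η : ℝ, 0 < η ∧ C * η ^ r ≤ ε / 2 := by
    have : Tendsto (fun η : ℝ => C * η ^ r) (𝓝[>] 0) (𝓝 (C * 0 ^ r)) :=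
      ((Real.continuousAt_rpow_const 0 r (Or.inr h0.le)).tendsto.const_mul C).mono_left
        nhdsWithin_le_nhds
    rw [Real.zero_rpow h0.ne', mul_zero] at this
    obtain ⟨η, h2, h3⟩ := ((this.eventually_le_const (half_pos hε)).and
      self_mem_nhdsWithin).exists
    exact ⟨η, h3, h2⟩
  -- The strip `0 < z.im < Y` is covered by finitely many horizontal lines with spacing `η`.
  -- Riemann–Lebesgue makes the function small on these, and `η` was chosen so that it varies by at
  -- most `ε / 2` in between.
  obtain ⟨N, hN⟩ := exists_nat_gt (Y / η)
  have hev : ∀ᶠ x : ℝ in cocompact ℝ, ∀ k ∈ Finset.range (N + 1),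
      ‖cauchy f ⟨x, (k + 1) * η⟩‖ ≤ ε / 2 := by
    refine (Finset.eventually_all _).2 fun k _ => ?_
    have := (tendsto_cauchy_horizontal hf (y := (k + 1) * η) (by positivity)).norm
    rw [norm_zero] at this
    exact this.eventually_le_const (half_pos hε)
  rw [← Metric.cobounded_eq_cocompact, (hasBasis_cobounded_norm (E := ℝ)).eventually_iff] at hev
  obtain ⟨R, -, hR⟩ := hev
  refine ⟨R + Y, fun z hz hzR => ?_⟩
  rcases le_or_gt Y z.im with hzY | hzY
  · exact hY z hzY
  set k := ⌊z.im / η⌋₊ with hk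
  have hk1 : k * η ≤ z.im := by
    have := Nat.floor_le (a := z.im / η) (by positivity)
    rwa [le_div_iff₀ hη0] at this
  have hk2 : z.im < (k + 1) * η := by
    have := Nat.lt_floor_add_one (z.im / η)
    rwa [div_lt_iff₀ hη0] at this
  have hkN : k < N + 1 := by
    have : (k : ℝ) < N := by
      refine lt_of_le_of_lt ?_ hN
      rw [le_div_iff₀ hη0]; linarith
    have : k < N := by exact_mod_cast this
    omega
  have hre : R ≤ ‖z.re‖ := by
    have := Complex.norm_le_abs_re_add_abs_im z
    rw [abs_of_pos hz] at this
    rw [Real.norm_eq_abs]; linarith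
  have e1 := hR hre k (Finset.mem_range.2 hkN)
  have e2 := h z ⟨z.re, (k + 1) * η⟩ hz (by simp only; positivity)
  have e3 : ‖z - ⟨z.re, (k + 1) * η⟩‖ = |z.im - (k + 1) * η| := norm_mk_sub_mk_im z.re z.im _
  have e4 : C * |z.im - (k + 1) * η| ^ r ≤ C * η ^ r := by
    gcongr
    rw [abs_le]; constructor <;> linarith
  rw [e3] at e2
  have := norm_le_norm_sub_add (cauchy f z) (cauchy f ⟨z.re, (k + 1) * η⟩)
  linarith

/-- Reflection exchanges the half-planes, so decay below follows from decay above. -/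
theorem cauchy_comp_neg (f : ℝ → ℂ) (z : ℂ) : cauchy (fun x => f (-x)) z = -cauchy f (-z) := by
  rw [cauchy, cauchy, ← mul_neg, ← integral_neg, ← integral_neg_eq_self]
  congr 2
  ext x
  rw [neg_neg, ← mul_neg, ← inv_neg]
  congr 2
  push_cast; ring

theorem cauchy_small_lower {f : ℝ → ℂ} {A r : ℝ} (hf : MemLp f 2) (h0 : 0 < r)
    (h1 : r < 1) (hH : ∀ x y, ‖f x - f y‖ ≤ A * |x - y| ^ r) {ε : ℝ} (hε : 0 < ε) :
    ∃ R, ∀ z : ℂ, z.im < 0 → R ≤ ‖z‖ → ‖cauchy f z‖ ≤ ε := by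
  obtain ⟨R, hR⟩ := cauchy_small_upper (f := fun x => f (-x))
    (hf.comp_measurePreserving (Measure.measurePreserving_neg volume)) h0 h1
    (fun x y => by simpa [neg_add_eq_sub, abs_sub_comm] using hH (-x) (-y)) hε
  refine ⟨R, fun z hz hzR => ?_⟩
  simpa [cauchy_comp_neg] using hR (-z) (by simpa using hz) (by simpa using hzR)

/-! ### Holomorphy and boundary values of the Cauchy integral. -/

theorem differentiableAt_cauchy {f : ℝ → ℂ} (hf : MemLp f 2) {z : ℂ} (hz : z.im ≠ 0) :
    DifferentiableAt ℂ (cauchy f) z := by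
  have hy : 0 < |z.im| := abs_pos.2 hz
  -- On this ball `w` moves by less than half the distance from `z` to the line, so the derivative
  -- integrand is at most four times its norm at `z`.
  have far : ∀ w ∈ Metric.ball z (|z.im| / 2), ∀ s : ℝ,
      w.im ≠ 0 ∧ ‖(s : ℂ) - z‖ ≤ 2 * ‖(s : ℂ) - w‖ := fun w hw s => by
    rw [Metric.mem_ball, dist_eq_norm] at hw
    have e1 := Complex.abs_im_le_norm ((s : ℂ) - z)
    have e2 : ‖(s : ℂ) - z‖ ≤ ‖(s : ℂ) - w‖ + ‖w - z‖ := norm_sub_le_norm_sub_add_norm_sub _ _ _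
    have e3 := Complex.abs_im_le_norm (w - z)
    simp only [Complex.sub_im, Complex.ofReal_im, zero_sub, abs_neg] at e1 e3
    refine ⟨fun h => ?_, by linarith⟩
    rw [h, zero_sub, abs_neg] at e3
    linarith
  have h := hasDerivAt_integral_of_dominated_loc_of_deriv_le (μ := volume)
    (F := fun (w : ℂ) (s : ℝ) => f s * ((s : ℂ) - w)⁻¹)
    (F' := fun (w : ℂ) (s : ℝ) => f s * (((s : ℂ) - w)⁻¹ * ((s : ℂ) - w)⁻¹))
    (x₀ := z) (bound := fun s : ℝ => 4 * ‖f s * (((s : ℂ) - z)⁻¹ * ((s : ℂ) - z)⁻¹)‖)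
    (Metric.ball_mem_nhds z (half_pos hy)) ?_ (integrable_mul_kernel hf hz)
    (integrable_mul_kernel_mul_kernel hf hz hz).aestronglyMeasurable ?_
    ((integrable_mul_kernel_mul_kernel hf hz hz).norm.const_mul 4) ?_
  · exact (h.2.differentiableAt).const_mul _
  · filter_upwards [Metric.ball_mem_nhds z (half_pos hy)] with w hw
    exact (integrable_mul_kernel hf (far w hw 0).1).aestronglyMeasurable
  · refine Eventually.of_forall fun s w hw => ?_
    have h2 := (far w hw s).2
    have h3 : 0 < ‖(s : ℂ) - z‖ := norm_pos_iff.2 (sub_ne_zero_of_im_ne_zero hz s)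
    have h4 : ‖(s : ℂ) - w‖⁻¹ ≤ 2 * ‖(s : ℂ) - z‖⁻¹ := by
      rw [← div_eq_mul_inv, le_div_iff₀ h3, inv_mul_le_iff₀ (by linarith)]
      linarith
    simp only [norm_mul, norm_inv]
    calc _ ≤ ‖f s‖ * ((2 * ‖(s : ℂ) - z‖⁻¹) * (2 * ‖(s : ℂ) - z‖⁻¹)) := by gcongr
      _ = _ := by ring
  · refine Eventually.of_forall fun s w hw => ?_
    have hne := sub_ne_zero_of_im_ne_zero (far w hw 0).1 s
    have h2 : HasDerivAt (fun w : ℂ => (s : ℂ) - w) (-1) w := (hasDerivAt_id' w).const_sub (s : ℂ)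
    refine ((h2.fun_inv hne).const_mul (f s)).congr_deriv ?_
    field_simp

theorem neBot_upper (x : ℝ) : (𝓝[upper] (x : ℂ)).NeBot := by
  rw [← mem_closure_iff_nhdsWithin_neBot, upper, Complex.closure_setOfPred_lt_im]
  simp

theorem neBot_lower (x : ℝ) : (𝓝[lower] (x : ℂ)).NeBot := by
  rw [← mem_closure_iff_nhdsWithin_neBot, lower, Complex.closure_setOfPred_im_lt]
  simp

theorem tendsto_vertical (x : ℝ) :
    Tendsto (fun y : ℝ => (x : ℂ) + y * Complex.I) (𝓝[>] 0) (𝓝[upper] (x : ℂ)) := by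
  refine tendsto_nhdsWithin_iff.2 ⟨?_, ?_⟩
  · have : Continuous fun y : ℝ => (x : ℂ) + y * Complex.I := by fun_prop
    have h := this.tendsto 0
    simp only [Complex.ofReal_zero, zero_mul, add_zero] at h
    exact h.mono_left nhdsWithin_le_nhds
  · filter_upwards [self_mem_nhdsWithin] with y hy
    simpa [upper] using hy

/-- The estimate makes `P` uniformly continuous on the half-plane, and `ℂ` is complete. -/
theorem exists_tendsto_of_holder {P : ℂ → ℂ} {C r : ℝ} (h0 : 0 < r)
    (h : ∀ z w : ℂ, 0 < z.im → 0 < w.im → ‖P z - P w‖ ≤ C * ‖z - w‖ ^ r) (x : ℝ) :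
    ∃ c, Tendsto P (𝓝[upper] (x : ℂ)) (𝓝 c) := by
  have := neBot_upper x
  refine cauchy_map_iff_exists_tendsto.1 ?_
  refine Cauchy.map_of_le (s := upper) (cauchy_nhds.mono inf_le_left) ?_ inf_le_right
  rw [Metric.uniformContinuousOn_iff]
  intro ε hε
  have ht : Tendsto (fun η : ℝ => C * η ^ r) (𝓝 0) (𝓝 (C * 0 ^ r)) :=
    (Real.continuousAt_rpow_const 0 r (Or.inr h0.le)).tendsto.const_mul C
  rw [Real.zero_rpow h0.ne', mul_zero] at ht
  obtain ⟨δ, hδ, h2⟩ := Metric.eventually_nhds_iff.1 (ht.eventually_lt_const hε)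
  refine ⟨δ, hδ, fun z hz w hw hzw => ?_⟩
  rw [dist_eq_norm] at hzw ⊢
  exact (h z w hz hw).trans_lt (h2 (by simpa using hzw))

theorem im_mul_I_pos {y : ℝ} (hy : y ∈ Set.Ioi (0 : ℝ)) : 0 < ((y : ℂ) * Complex.I).im := by
  simpa using hy

theorem tendsto_integral_schwartz_mul_cauchy {f c : ℝ → ℂ} (hf : MemLp f 2) {M : ℝ}
    (hM : ∀ z : ℂ, 0 < z.im → ‖cauchy f z‖ ≤ M) (hb : HasBoundary upper (cauchy f) c)
    (φ : SchwartzMap ℝ ℂ) :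
    Tendsto (fun y : ℝ => ∫ x : ℝ, φ x * cauchy f (x + y * Complex.I)) (𝓝[>] 0)
      (𝓝 (∫ x, φ x * c x)) := by
  refine tendsto_integral_filter_of_dominated_convergence (fun x => ‖φ x‖ * M) ?_ ?_
    (φ.integrable.norm.mul_const M) ?_
  · filter_upwards [self_mem_nhdsWithin] with y hy
    refine φ.continuous.aestronglyMeasurable.mul (Continuous.aestronglyMeasurable ?_)
    refine continuous_iff_continuousAt.2 fun x => ?_
    refine ContinuousAt.comp (g := cauchy f) ?_ (by fun_prop)
    refine (differentiableAt_cauchy hf ?_).continuousAt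
    have := (im_mul_I_pos hy).ne'
    rwa [Complex.add_im, Complex.ofReal_im, zero_add]
  · filter_upwards [self_mem_nhdsWithin] with y hy
    refine Eventually.of_forall fun x => ?_
    rw [norm_mul]
    gcongr
    exact hM _ (by simpa using hy)
  · exact Eventually.of_forall fun x => ((hb x).comp (tendsto_vertical x)).const_mul _

theorem tendsto_halfExp_mul (ξ : ℝ) (a : ℂ) :
    Tendsto (fun y : ℝ => halfExp (y * Complex.I) (-ξ) * a) (𝓝[>] 0)
      (𝓝 ((Set.Ioi (0 : ℝ)).indicator (fun _ => a) ξ)) := by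
  by_cases hξ : ξ ∈ Set.Ioi (0 : ℝ)
  · rw [Set.indicator_of_mem hξ]
    have h3 : Tendsto (fun y : ℝ => Complex.exp (-2 * Real.pi * Complex.I * (y * Complex.I) *
        (-ξ : ℝ)) * a) (𝓝[>] 0) (𝓝 a) := by
      have : Continuous fun y : ℝ => Complex.exp (-2 * Real.pi * Complex.I * (y * Complex.I) *
        (-ξ : ℝ)) * a := by fun_prop
      have h4 := this.tendsto 0
      simp only [Complex.ofReal_zero, zero_mul, mul_zero, Complex.exp_zero, one_mul] at h4
      exact h4.mono_left nhdsWithin_le_nhds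
    refine h3.congr' ?_
    filter_upwards [self_mem_nhdsWithin] with y hy
    rw [halfExp, if_pos]
    rw [neg_mul, neg_lt_zero]
    exact mul_pos hξ (im_mul_I_pos hy)
  · rw [Set.indicator_of_notMem hξ]
    refine tendsto_const_nhds.congr' ?_
    filter_upwards [self_mem_nhdsWithin] with y hy
    rw [halfExp, if_neg, zero_mul]
    rw [neg_mul, neg_lt_zero, mul_pos_iff_of_pos_right (im_mul_I_pos hy)]
    exact hξ

theorem tendsto_integral_mul_halfExp {u g : ℝ → ℂ} (hu : MemLp u 2) (hg : MemLp g 2) :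
    Tendsto (fun y : ℝ => ∫ ξ, u ξ * (halfExp (y * Complex.I) (-ξ) * g ξ))
      (𝓝[>] 0) (𝓝 (∫ ξ, u ξ * (Set.Ioi (0 : ℝ)).indicator g ξ)) := by
  refine tendsto_integral_filter_of_dominated_convergence (fun ξ => ‖u ξ * g ξ‖)
    ?_ ?_ (hu.integrable_mul hg).norm ?_
  · filter_upwards [self_mem_nhdsWithin] with y hy
    refine hu.aestronglyMeasurable.mul (AEStronglyMeasurable.mul ?_ hg.aestronglyMeasurable)
    exact ((memLp_halfExp (im_mul_I_pos hy).ne').comp_measurePreserving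
      (Measure.measurePreserving_neg volume)).aestronglyMeasurable
  · filter_upwards [self_mem_nhdsWithin] with y hy
    refine Eventually.of_forall fun ξ => ?_
    rw [norm_mul, norm_mul, norm_mul]
    gcongr
    refine mul_le_of_le_one_left (norm_nonneg _) ?_
    rw [norm_halfExp_neg]
    split_ifs with h
    · exact Real.exp_le_one_iff.2 (by have := Real.pi_pos; simp only [neg_nonpos]; positivity)
    · exact zero_le_one
  · exact Eventually.of_forall fun ξ => Tendsto.const_mul _ (tendsto_halfExp_mul ξ (g ξ))

/-- The boundary function of a Cauchy integral has the positive part of the spectrum. -/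
theorem boundary_ae_eq {f c : ℝ → ℂ} (hf : MemLp f 2) {M : ℝ}
    (hM : ∀ z : ℂ, 0 < z.im → ‖cauchy f z‖ ≤ M) (hc : Continuous c)
    (hb : HasBoundary upper (cauchy f) c) {v : Lp ℂ 2 (volume : Measure ℝ)}
    (hv : v =ᵐ[volume] (Set.Ioi (0 : ℝ)).indicator
      (𝓕 (hf.toLp f) : Lp ℂ 2 (volume : Measure ℝ))) :
    (𝓕⁻ v : Lp ℂ 2 (volume : Measure ℝ)) =ᵐ[volume] c := by
  refine ae_eq_of_forall_schwartz (locallyIntegrable_Lp _) hc.locallyIntegrable fun φ => ?_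
  rw [integral_schwartz_mul_fourierInv]
  have hφ : MemLp (𝓕⁻ (φ : ℝ → ℂ)) 2 := by
    rw [← SchwartzMap.fourierInv_coe]; exact (𝓕⁻ φ : SchwartzMap ℝ ℂ).memLp 2 volume
  have e1 := tendsto_integral_schwartz_mul_cauchy hf hM hb φ
  have e2 := tendsto_integral_mul_halfExp hφ
    (Lp.memLp (𝓕 (hf.toLp f) : Lp ℂ 2 (volume : Measure ℝ)))
  have e3 : (fun y : ℝ => ∫ x : ℝ, φ x * cauchy f (x + y * Complex.I)) =ᶠ[𝓝[>] 0]
      fun y : ℝ => ∫ ξ, 𝓕⁻ (φ : ℝ → ℂ) ξ * (halfExp (y * Complex.I) (-ξ) *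
        (𝓕 (hf.toLp f) : Lp ℂ 2 (volume : Measure ℝ)) ξ) := by
    filter_upwards [self_mem_nhdsWithin] with y hy
    have hy' := im_mul_I_pos hy
    rw [← integral_mul_fourierInv_eq_flip φ.integrable
      (integrable_halfExp_neg_mul_fourier _ hy'.ne')]
    congr 1
    ext x
    rw [fourierInv_halfExp_mul_fourier hf hy'.ne', Real.sign_of_pos hy', Complex.ofReal_one,
      one_mul]
  -- As the height tends to zero, the same pairing has a limit on the function side and one on the
  -- Fourier side.
  rw [tendsto_nhds_unique (e1.congr' e3) e2]
  refine integral_congr_ae ?_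
  filter_upwards [hv] with ξ hξ
  rw [hξ]

/-- Sokhotski–Plemelj: the additive splitting of a Hölder continuous function of `L²`. -/
theorem exists_additive_splitting {f : ℝ → ℂ} {A r : ℝ} (hf : MemLp f 2) (h0 : 0 < r)
    (h1 : r < 1) (hH : ∀ x y, ‖f x - f y‖ ≤ A * |x - y| ^ r) :
    ∃ c : ℝ → ℂ, ∃ C M : ℝ, HasBoundary upper (cauchy f) c ∧
      HasBoundary lower (fun z => -cauchy f z) (fun x => f x - c x) ∧
      (∀ x y, ‖c x - c y‖ ≤ C * |x - y| ^ r) ∧ (∀ x, ‖c x‖ ≤ M) ∧ MemLp c 2 ∧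
      (∀ z : ℂ, z.im < 0 → cauchy c z = 0) ∧
      ∀ z : ℂ, 0 < z.im → cauchy (fun x => f x - c x) z = 0 := by
  obtain ⟨C, hC, hC'⟩ := exists_norm_cauchy_sub_le hf h0 h1 hH
  obtain ⟨M, hM⟩ := exists_norm_cauchy_le hf h0 h1 hH
  obtain ⟨J, hJ⟩ := exists_norm_cauchy_jump_le hf h0 h1 hH
  choose c hc using exists_tendsto_of_holder h0 hC'
  have hcH : ∀ x y, ‖c x - c y‖ ≤ C * |x - y| ^ r := fun x y => by
    refine le_of_tendsto (((hc x).comp (tendsto_vertical x)).sub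
      ((hc y).comp (tendsto_vertical y))).norm ?_
    filter_upwards [self_mem_nhdsWithin] with η hη
    have := hC' (x + η * Complex.I) (y + η * Complex.I) (by simpa using hη) (by simpa using hη)
    rwa [add_sub_add_right_eq_sub, ← Complex.ofReal_sub, Complex.norm_real] at this
  have hcM : ∀ x, ‖c x‖ ≤ M := fun x => by
    have := neBot_upper x
    refine le_of_tendsto (hc x).norm ?_
    filter_upwards [self_mem_nhdsWithin] with z hz using hM z hz
  have hcont : ∀ {g : ℝ → ℂ} {B : ℝ}, (∀ x y, ‖g x - g y‖ ≤ B * |x - y| ^ r) → Continuous g := by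
    intro g B hg
    refine continuous_iff_continuousAt.2 fun x => tendsto_iff_norm_sub_tendsto_zero.2 ?_
    have h3 : Tendsto (fun y : ℝ => B * |y - x| ^ r) (𝓝 x) (𝓝 (B * |x - x| ^ r)) := by
      have : Continuous fun y : ℝ => B * |y - x| ^ r :=
        continuous_const.mul (Continuous.rpow_const (by fun_prop) fun _ => Or.inr h0.le)
      exact this.tendsto x
    rw [sub_self, abs_zero, Real.zero_rpow h0.ne', mul_zero] at h3
    exact squeeze_zero (fun _ => norm_nonneg _) (fun y => hg y x) h3
  set g := (𝓕 (hf.toLp f) : Lp ℂ 2 (volume : Measure ℝ)) with hg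
  set v := ((Lp.memLp g).indicator (measurableSet_Ioi (a := (0 : ℝ)))).toLp with hv
  have hv' : v =ᵐ[volume] (Set.Ioi (0 : ℝ)).indicator g := MemLp.coeFn_toLp _
  -- The spectrum of `c` is the restriction of that of `f` to the positive half-line; hence `c` is
  -- in `L²` and `f - c` has the remaining spectrum.
  have hae := boundary_ae_eq hf hM (hcont hcH) hc hv'
  have hcL : MemLp c 2 := (Lp.memLp _).ae_eq hae
  have hcv : (𝓕 (hcL.toLp c) : Lp ℂ 2 (volume : Measure ℝ)) = v := by
    have : hcL.toLp c = 𝓕⁻ v := by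
      refine Lp.ext ?_
      exact hcL.coeFn_toLp.trans hae.symm
    rw [this, FourierTransform.fourier_fourierInv_eq]
  have hdL : MemLp (fun x => f x - c x) 2 := hf.sub hcL
  refine ⟨c, C, M, hc, fun x => ?_, hcH, hcM, hcL, fun z hz => ?_, fun z hz => ?_⟩
  · have t1 : Tendsto (starRingEnd ℂ) (𝓝[lower] (x : ℂ)) (𝓝[upper] (x : ℂ)) := by
      refine tendsto_nhdsWithin_iff.2 ⟨?_, ?_⟩
      · have := (Complex.continuous_conj.tendsto (x : ℂ))
        rw [Complex.conj_ofReal] at this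
        exact this.mono_left nhdsWithin_le_nhds
      · filter_upwards [self_mem_nhdsWithin] with z hz
        simpa [upper, lower] using hz
    have t2 : Tendsto (fun z : ℂ => f z.re) (𝓝[lower] (x : ℂ)) (𝓝 (f x)) := by
      have := ((hcont hH).comp Complex.continuous_re).tendsto (x : ℂ)
      exact this.mono_left nhdsWithin_le_nhds
    -- The jump estimate at the conjugate point transfers the limit from above to the lower side.
    have t3 : Tendsto (fun z : ℂ => -cauchy f z - (f z.re - cauchy f ((starRingEnd ℂ) z)))
        (𝓝[lower] (x : ℂ)) (𝓝 0) := by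
      have h4 : Tendsto (fun z : ℂ => J * |z.im| ^ r) (𝓝[lower] (x : ℂ)) (𝓝 0) := by
        have : Continuous fun z : ℂ => J * |z.im| ^ r :=
          continuous_const.mul (Continuous.rpow_const (by fun_prop) fun _ => Or.inr h0.le)
        have h5 := this.tendsto (x : ℂ)
        simp only [Complex.ofReal_im, abs_zero, Real.zero_rpow h0.ne', mul_zero] at h5
        exact h5.mono_left nhdsWithin_le_nhds
      refine squeeze_zero_norm' ?_ h4
      filter_upwards [self_mem_nhdsWithin] with z hz
      have hz' : z.im < 0 := hz
      have := hJ ((starRingEnd ℂ) z) (by simpa using hz')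
      rw [Complex.conj_conj, Complex.conj_re, Complex.conj_im] at this
      rw [abs_of_neg hz']
      have e : -cauchy f z - (f z.re - cauchy f ((starRingEnd ℂ) z)) =
          cauchy f ((starRingEnd ℂ) z) - cauchy f z - f z.re := by ring
      rwa [e]
    have := t3.add (t2.sub ((hc x).comp t1))
    simpa using this
  · refine (cauchy_eq_zero_iff hcL (s := -1) (by norm_num)).2 ?_ z (by simpa using hz)
    rw [hcv]
    filter_upwards [hv'] with ξ h2 h3
    rw [h2, Set.indicator_of_notMem]
    simp only [Set.mem_Ioi]; linarith
  · refine (cauchy_eq_zero_iff hdL (s := 1) (by norm_num)).2 ?_ z (by simpa using hz)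
    have h2 : hdL.toLp (fun x => f x - c x) = hf.toLp f - hcL.toLp c := MemLp.toLp_sub hf hcL
    have h3 : (𝓕 (hf.toLp f - hcL.toLp c) : Lp ℂ 2 (volume : Measure ℝ)) = g - v := by
      rw [← hcv, hg]
      exact (Lp.fourierTransformₗᵢ ℝ ℂ).map_sub _ _
    rw [h2, h3]
    filter_upwards [hv', Lp.coeFn_sub g v] with ξ h4 h5 h6
    rw [h5, Pi.sub_apply, h4, Set.indicator_of_mem (by simpa using h6), sub_self]

/-! ### Products and exponentials of functions with one-sided spectrum. -/

theorem cauchy_conj (f : ℝ → ℂ) (z : ℂ) : cauchy (fun x => (starRingEnd ℂ) (f x)) z =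
    -(starRingEnd ℂ) (cauchy f ((starRingEnd ℂ) z)) := by
  rw [cauchy, cauchy, map_mul, ← integral_conj, ← neg_mul]
  congr 1
  · simp [map_ofNat]
  · congr 1; ext x; simp

/-- Functions with spectrum on the same half-line are orthogonal for the bilinear pairing. -/
theorem integral_mul_eq_zero {f h : ℝ → ℂ} (hf : MemLp f 2) (hh : MemLp h 2) {s : ℝ} (hs : s ≠ 0)
    (hf0 : ∀ z : ℂ, 0 < s * z.im → cauchy f z = 0) (hh0 : ∀ z : ℂ, 0 < s * z.im → cauchy h z = 0) :
    ∫ x, f x * h x = 0 := by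
  -- The pairing is the inner product of the conjugate of `f` with `h`. Conjugation reflects the
  -- spectrum, so the two spectra are disjoint.
  have hg : MemLp (fun x => (starRingEnd ℂ) (f x)) 2 := hf.star
  have hg0 : ∀ z : ℂ, 0 < -s * z.im → cauchy (fun x => (starRingEnd ℂ) (f x)) z = 0 :=
    fun z hz => by rw [cauchy_conj, hf0 _ (by simpa using hz), map_zero, neg_zero]
  have h1 := (cauchy_eq_zero_iff hg (neg_ne_zero.2 hs)).1 hg0
  have h2 := (cauchy_eq_zero_iff hh hs).1 hh0
  have h3 := Lp.inner_fourier_eq (hg.toLp _) (hh.toLp _)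
  rw [L2.inner_def, L2.inner_def] at h3
  calc _ = _ := integral_congr_ae ?_
    _ = _ := h3.symm
    _ = _ := integral_eq_zero_of_ae ?_
  · filter_upwards [hg.coeFn_toLp, hh.coeFn_toLp] with x e1 e2
    rw [e1, e2, RCLike.inner_apply, Complex.conj_conj, mul_comm]
  · have h0 : ∀ᵐ ξ : ℝ, ξ ≠ 0 := by simp [ae_iff]
    filter_upwards [h1, h2, h0] with ξ e1 e2 e0
    rcases (mul_ne_zero hs e0).lt_or_gt with h | h
    · rw [e1 (by linarith), inner_zero_left, Pi.zero_apply]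
    · rw [e2 h, inner_zero_right, Pi.zero_apply]

theorem memLp_mul_kernel {f : ℝ → ℂ} (hf : MemLp f 2) {z : ℂ} (hz : z.im ≠ 0) :
    MemLp (fun x : ℝ => f x * ((x : ℂ) - z)⁻¹) 2 := by
  refine hf.of_le_mul (c := |z.im|⁻¹)
    (hf.aestronglyMeasurable.mul (memLp_kernel hz).aestronglyMeasurable)
    (Eventually.of_forall fun x => ?_)
  rw [norm_mul, mul_comm, norm_inv]
  refine mul_le_mul_of_nonneg_right ?_ (norm_nonneg _)
  exact inv_anti₀ (abs_pos.2 hz) (by simpa using Complex.abs_im_le_norm ((x : ℂ) - z))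

/-- For `w ≠ z` the integral is a difference quotient of `cauchy f`, which vanishes; the case `w =
z` follows by continuity. -/
theorem cauchy_mul_kernel_eq_zero {f : ℝ → ℂ} (hf : MemLp f 2) {s : ℝ}
    (hf0 : ∀ z : ℂ, 0 < s * z.im → cauchy f z = 0) {z w : ℂ} (hz : 0 < s * z.im)
    (hw : 0 < s * w.im) : cauchy (fun x : ℝ => f x * ((x : ℂ) - z)⁻¹) w = 0 := by
  have hz' : z.im ≠ 0 := right_ne_zero_of_mul hz.ne'
  have key : ∀ w : ℂ, 0 < s * w.im → w ≠ z →
      cauchy (fun x : ℝ => f x * ((x : ℂ) - z)⁻¹) w = 0 := fun w hw hwz => by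
    have h := cauchy_sub_cauchy hf hz' (right_ne_zero_of_mul hw.ne')
    rw [hf0 z hz, hf0 w hw, sub_zero, mul_assoc, eq_comm, mul_eq_zero] at h
    have h2 := h.resolve_left (sub_ne_zero.2 hwz.symm)
    simpa only [cauchy, mul_assoc] using h2
  rcases eq_or_ne w z with rfl | hne
  · have hc := (differentiableAt_cauchy (memLp_mul_kernel hf hz') hz').continuousAt
    refine tendsto_nhds_unique (hc.tendsto.mono_left nhdsWithin_le_nhds : Tendsto _ (𝓝[≠] w) _)
      (tendsto_const_nhds.congr' ?_)
    have ho : ∀ᶠ v : ℂ in 𝓝 w, 0 < s * v.im :=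
      (continuous_const.mul Complex.continuous_im).continuousAt.eventually_const_lt hz
    filter_upwards [self_mem_nhdsWithin, ho.filter_mono nhdsWithin_le_nhds] with v hv hv2
    exact (key v hv2 hv).symm
  · exact key w hw hne

/-- The Cauchy integral of the product is the bilinear pairing of `f` with `g / (x - z)`, and both
have one-sided spectrum. -/
theorem cauchy_mul_eq_zero {f g : ℝ → ℂ} (hf : MemLp f 2) (hg : MemLp g 2) {s : ℝ} (hs : s ≠ 0)
    (hf0 : ∀ z : ℂ, 0 < s * z.im → cauchy f z = 0) (hg0 : ∀ z : ℂ, 0 < s * z.im → cauchy g z = 0)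
    {z : ℂ} (hz : 0 < s * z.im) : cauchy (fun x => f x * g x) z = 0 := by
  have h := integral_mul_eq_zero hf (memLp_mul_kernel hg (right_ne_zero_of_mul hz.ne')) hs hf0
    fun w hw => cauchy_mul_kernel_eq_zero hg hg0 hz hw
  simp only [cauchy, mul_assoc, h, mul_zero]

theorem memLp_pow_succ {c : ℝ → ℂ} {M : ℝ} (hc : MemLp c 2) (hM : ∀ x, ‖c x‖ ≤ M) (n : ℕ) :
    MemLp (fun x => c x ^ (n + 1)) 2 := by
  refine hc.of_le_mul (c := M ^ n) (hc.aestronglyMeasurable.pow _) (Eventually.of_forall fun x => ?_)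
  rw [norm_pow, pow_succ]
  gcongr
  exact hM x

theorem cauchy_pow_succ_eq_zero {c : ℝ → ℂ} {M : ℝ} (hc : MemLp c 2) (hM : ∀ x, ‖c x‖ ≤ M) {s : ℝ}
    (hs : s ≠ 0) (hc0 : ∀ z : ℂ, 0 < s * z.im → cauchy c z = 0) (n : ℕ) :
    ∀ z : ℂ, 0 < s * z.im → cauchy (fun x => c x ^ (n + 1)) z = 0 := by
  induction n with
  | zero => simpa using hc0
  | succ n ih =>
    intro z hz
    simp_rw [pow_succ _ (n + 1)]
    exact cauchy_mul_eq_zero (memLp_pow_succ hc hM n) hc hs ih hc0 hz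

theorem norm_exp_sub_one_le (a : ℂ) : ‖Complex.exp a - 1‖ ≤ ‖a‖ * Real.exp ‖a‖ := by
  simpa using Complex.norm_exp_sub_sum_le_norm_mul_exp a 1

theorem memLp_exp_sub_one {c : ℝ → ℂ} {M : ℝ} (hc : MemLp c 2) (hM : ∀ x, ‖c x‖ ≤ M) :
    MemLp (fun x => Complex.exp (c x) - 1) 2 := by
  refine hc.of_le_mul (c := Real.exp M)
    ((Complex.continuous_exp.comp_aestronglyMeasurable hc.aestronglyMeasurable).sub
      aestronglyMeasurable_const) (Eventually.of_forall fun x => ?_)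
  refine (norm_exp_sub_one_le _).trans ?_
  rw [mul_comm]
  gcongr
  exact hM x

/-- The exponential preserves one-sidedness of the spectrum. -/
theorem cauchy_exp_sub_one_eq_zero {c : ℝ → ℂ} {M : ℝ} (hc : MemLp c 2) (hM : ∀ x, ‖c x‖ ≤ M)
    {s : ℝ} (hs : s ≠ 0) (hc0 : ∀ z : ℂ, 0 < s * z.im → cauchy c z = 0) {z : ℂ}
    (hz : 0 < s * z.im) : cauchy (fun x => Complex.exp (c x) - 1) z = 0 := by
  have hz' : z.im ≠ 0 := right_ne_zero_of_mul hz.ne'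
  have hM0 : 0 ≤ M := (norm_nonneg _).trans (hM 0)
  -- The exponential series without its constant term, integrated termwise.
  set F : ℕ → ℝ → ℂ := fun n x => ((n + 1).factorial : ℂ)⁻¹ * (c x ^ (n + 1) * ((x : ℂ) - z)⁻¹)
  have hFi : ∀ n, Integrable (F n) := fun n =>
    (integrable_mul_kernel (memLp_pow_succ hc hM n) hz').const_mul _
  have hF0 : ∀ n, ∫ x, F n x = 0 := fun n => by
    have := cauchy_pow_succ_eq_zero hc hM hs hc0 n z hz
    rw [cauchy, mul_eq_zero] at this
    have h2 := this.resolve_left (by simp [Real.pi_ne_zero])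
    simp only [F]
    rw [integral_const_mul, h2, mul_zero]
  -- One factor `c x` is kept, since the kernel alone is not integrable; the other `n` are bounded
  -- by `M`, which leaves `M^n / n!`.
  have hFs : Summable fun n => ∫ x, ‖F n x‖ := by
    have hi := (integrable_mul_kernel hc hz').norm
    refine Summable.of_nonneg_of_le (fun n => integral_nonneg fun x => norm_nonneg _) (fun n => ?_)
      ((Real.summable_pow_div_factorial M).mul_right (∫ x : ℝ, ‖c x * ((x : ℂ) - z)⁻¹‖))
    rw [← integral_const_mul]
    refine integral_mono (hFi n).norm (hi.const_mul _) fun x => ?_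
    simp only [F, norm_mul, norm_inv, norm_pow, Complex.norm_natCast]
    rw [pow_succ, div_eq_inv_mul]
    have h1 : ((n + 1).factorial : ℝ)⁻¹ ≤ (n.factorial : ℝ)⁻¹ := by
      gcongr
      exact n.le_succ
    have h2 : ‖c x‖ ^ n ≤ M ^ n := by gcongr; exact hM x
    calc _ ≤ (n.factorial : ℝ)⁻¹ * ((M ^ n * ‖c x‖) * ‖(x : ℂ) - z‖⁻¹) := by gcongr
      _ = _ := by ring
  have hsum := hasSum_integral_of_summable_integral_norm hFi hFs
  simp only [hF0] at hsum
  have h0 := hsum.unique hasSum_zero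
  have hx : ∀ x : ℝ, ∑' n, F n x = (Complex.exp (c x) - 1) * ((x : ℂ) - z)⁻¹ := fun x => by
    have h1 := NormedSpace.expSeries_div_hasSum_exp (𝔸 := ℂ) (c x)
    rw [← Complex.exp_eq_exp_ℂ, hasSum_nat_add_iff' 1 |>.symm] at h1
    simp only [Finset.range_one, Finset.sum_singleton, pow_zero, Nat.factorial_zero, Nat.cast_one,
      div_one] at h1
    rw [← (h1.mul_right (((x : ℂ) - z)⁻¹)).tsum_eq]
    congr 1; ext n
    simp only [F]; ring
  simp_rw [hx] at h0
  rw [cauchy, h0, mul_zero]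

/-! ### The class `L²` ∩ Hölder. -/

theorem exp_holder {c : ℝ → ℂ} {M C r : ℝ} (hM : ∀ x, ‖c x‖ ≤ M)
    (hH : ∀ x y, ‖c x - c y‖ ≤ C * |x - y| ^ r) (x y : ℝ) :
    ‖Complex.exp (c x) - Complex.exp (c y)‖ ≤ (Real.exp M * Real.exp (2 * M) * C) * |x - y| ^ r := by
  have h : Complex.exp (c x) - Complex.exp (c y) =
      Complex.exp (c y) * (Complex.exp (c x - c y) - 1) := by
    rw [mul_sub, ← Complex.exp_add]; ring_nf
  have h1 : ‖Complex.exp (c y)‖ ≤ Real.exp M := by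
    rw [Complex.norm_exp]
    exact Real.exp_le_exp.2 ((Complex.re_le_norm _).trans (hM y))
  have h2 : ‖c x - c y‖ ≤ 2 * M := (norm_sub_le _ _).trans (by linarith [hM x, hM y])
  rw [h, norm_mul]
  calc _ ≤ Real.exp M * ((C * |x - y| ^ r) * Real.exp (2 * M)) := by
        gcongr
        refine (norm_exp_sub_one_le _).trans ?_
        gcongr
        · exact (norm_nonneg _).trans (hH x y)
        · exact hH x y
    _ = _ := by ring

theorem memL2Holder_of {f : ℝ → ℂ} {C r : ℝ} (hf : MemLp f 2) (h0 : 0 < r) (h1 : r ≤ 1)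
    (hH : ∀ x y, ‖f x - f y‖ ≤ C * |x - y| ^ r) : MemL2Holder f := by
  have hC := holder_const_nonneg hH
  lift C to ℝ≥0 using hC
  lift r to ℝ≥0 using h0.le
  refine ⟨hf, C, r, h0, h1, fun x y => ?_⟩
  rw [edist_nndist, edist_nndist, ← ENNReal.coe_rpow_of_nonneg _ h0.le, ← ENNReal.coe_mul,
    ENNReal.coe_le_coe, ← NNReal.coe_le_coe]
  push_cast
  simpa [dist_eq_norm] using hH x y

/-- If `‖f x‖ ≥ ε`, then `‖f‖ ≥ ε / 2` on an interval of fixed length `2δ`, which contributes a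
fixed mass to the integral of `‖f‖²`. The mass of such an interval tends to zero as it moves to
infinity. -/
theorem holder_tendsto_zero {f : ℝ → ℂ} {A r : ℝ} (hf : MemLp f 2) (h0 : 0 < r)
    (hH : ∀ x y, ‖f x - f y‖ ≤ A * |x - y| ^ r) : Tendsto f (cocompact ℝ) (𝓝 0) := by
  have hA := holder_const_nonneg hH
  rw [tendsto_zero_iff_norm_tendsto_zero]
  have hi : Integrable fun x => ‖f x‖ ^ 2 :=
    (memLp_two_iff_integrable_sq_norm hf.aestronglyMeasurable).1 hf
  have hsmall : ∀ δ : ℝ, Tendsto (fun x => ∫ s in Set.Icc (x - δ) (x + δ), ‖f s‖ ^ 2)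
      (cocompact ℝ) (𝓝 0) := fun δ => by
    simp_rw [← integral_indicator measurableSet_Icc]
    rw [← integral_zero ℝ ℝ (μ := volume), cocompact_eq_atBot_atTop]
    refine tendsto_integral_filter_of_dominated_convergence (fun s => ‖f s‖ ^ 2)
      (Eventually.of_forall fun x => (hi.indicator measurableSet_Icc).aestronglyMeasurable)
      (Eventually.of_forall fun x => Eventually.of_forall fun s => ?_) hi
      (Eventually.of_forall fun s => tendsto_const_nhds.congr' ?_)
    · refine (norm_indicator_le_norm_self _ _).trans ?_
      simp
    · refine eventually_sup.2 ⟨?_, ?_⟩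
      · filter_upwards [eventually_lt_atBot (s - δ)] with x hx
        rw [Set.indicator_of_notMem]
        intro h; linarith [h.2]
      · filter_upwards [eventually_gt_atTop (s + δ)] with x hx
        rw [Set.indicator_of_notMem]
        intro h; linarith [h.1]
  refine tendsto_order.2 ⟨fun a ha => Eventually.of_forall fun x => ha.trans_le (norm_nonneg _),
    fun ε hε => ?_⟩
  obtain ⟨δ, hδ0, hδ⟩ : ∃ δ : ℝ, 0 < δ ∧ A * δ ^ r ≤ ε / 2 := by
    have : Tendsto (fun η : ℝ => A * η ^ r) (𝓝[>] 0) (𝓝 (A * 0 ^ r)) :=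
      ((Real.continuousAt_rpow_const 0 r (Or.inr h0.le)).tendsto.const_mul A).mono_left
        nhdsWithin_le_nhds
    rw [Real.zero_rpow h0.ne', mul_zero] at this
    obtain ⟨η, h2, h3⟩ := ((this.eventually_le_const (half_pos hε)).and
      self_mem_nhdsWithin).exists
    exact ⟨η, h3, h2⟩
  filter_upwards [(hsmall δ).eventually_lt_const (u := (ε / 2) ^ 2 * (2 * δ)) (by positivity)]
    with x hx
  by_contra! hxε
  have hle : ∫ _ in Set.Icc (x - δ) (x + δ), (ε / 2) ^ 2 ≤
      ∫ s in Set.Icc (x - δ) (x + δ), ‖f s‖ ^ 2 := by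
    refine setIntegral_mono_on (by simp) hi.integrableOn measurableSet_Icc fun s hs => ?_
    have h1 : |x - s| ≤ δ := by rw [abs_le]; constructor <;> linarith [hs.1, hs.2]
    have h2 : A * |x - s| ^ r ≤ A * δ ^ r := by gcongr
    have h3 := norm_le_norm_sub_add (f x) (f s)
    gcongr
    linarith [hH x s]
  rw [setIntegral_const] at hle
  simp only [measureReal_def, Real.volume_Icc, smul_eq_mul] at hle
  rw [ENNReal.toReal_ofReal (by linarith)] at hle
  linarith

/-- What is used about a function of `L² ∩ Hölder`. -/
theorem MemL2Holder.exists_holder {f : ℝ → ℂ} (hf : MemL2Holder f) :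
    Continuous f ∧ Tendsto f (cocompact ℝ) (𝓝 0) ∧ (∃ M, ∀ x, ‖f x‖ ≤ M) ∧
    ∃ A r : ℝ, 0 < r ∧ r < 1 ∧ ∀ x y, ‖f x - f y‖ ≤ A * |x - y| ^ r := by
  obtain ⟨h2, C, r, h0, h1, hH⟩ := hf
  have h0' : 0 < (r : ℝ) := h0
  have hc := hH.continuous h0
  have hH' : ∀ x y, ‖f x - f y‖ ≤ C * |x - y| ^ (r : ℝ) := fun x y => by
    simpa [dist_eq_norm] using hH.dist_le x y
  have ht := holder_tendsto_zero h2 h0' hH'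
  obtain ⟨M, hM⟩ : ∃ M, ∀ x, ‖f x‖ ≤ M := by
    have := ZeroAtInftyContinuousMap.isBounded_range (⟨⟨f, hc⟩, ht⟩ : ZeroAtInftyContinuousMap ℝ ℂ)
    obtain ⟨M, hM⟩ := this.exists_norm_le
    exact ⟨M, fun x => hM _ ⟨x, rfl⟩⟩
  have hM0 : 0 ≤ M := (norm_nonneg _).trans (hM 0)
  -- Halving the exponent makes it strictly less than `1`, as the singular integral estimates
  -- require; boundedness, through `2 * M`, covers distances above one.
  refine ⟨hc, ht, ⟨M, hM⟩, C + 2 * M, r / 2, by positivity, ?_, fun x y => ?_⟩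
  · have : (r : ℝ) ≤ 1 := h1
    linarith
  have hd := abs_nonneg (x - y)
  have hp : 0 ≤ |x - y| ^ ((r : ℝ) / 2) := by positivity
  rw [add_mul]
  rcases le_total |x - y| 1 with h | h
  · have h3 : |x - y| ^ (r : ℝ) ≤ |x - y| ^ ((r : ℝ) / 2) :=
      Real.rpow_le_rpow_of_exponent_ge_of_imp hd h (by linarith) (fun _ _ => by linarith)
    have h4 := mul_le_mul_of_nonneg_left h3 C.coe_nonneg
    have h5 : 0 ≤ 2 * M * |x - y| ^ ((r : ℝ) / 2) := by positivity
    linarith [hH' x y]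
  · have h3 : 1 ≤ |x - y| ^ ((r : ℝ) / 2) := Real.one_le_rpow h (by positivity)
    have h4 : ‖f x - f y‖ ≤ 2 * M := (norm_sub_le _ _).trans (by linarith [hM x, hM y])
    have h5 : 0 ≤ C * |x - y| ^ ((r : ℝ) / 2) := by positivity
    nlinarith

/-! ### Gluing across the real line, identity theorem and Liouville. -/

theorem isOpen_upper : IsOpen upper := isOpen_lt continuous_const Complex.continuous_im

theorem isOpen_lower : IsOpen lower := isOpen_lt Complex.continuous_im continuous_const

theorem integral_boundary_rect_of_edge_on_real {f : ℂ → ℂ} (hc : Continuous f)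
    (hu : DifferentiableOn ℂ f upper) (hl : DifferentiableOn ℂ f lower) {z w : ℂ}
    (h : z.im = 0 ∨ w.im = 0) :
    (∫ x : ℝ in z.re..w.re, f (x + z.im * Complex.I)) -
      (∫ x : ℝ in z.re..w.re, f (x + w.im * Complex.I)) +
      Complex.I • (∫ y : ℝ in z.im..w.im, f (w.re + y * Complex.I)) -
      Complex.I • (∫ y : ℝ in z.im..w.im, f (z.re + y * Complex.I)) = 0 := by
  refine Complex.integral_boundary_rect_eq_zero_of_continuousOn_of_differentiableOn f z w
    hc.continuousOn ?_
  have h2 : (0 ≤ z.im ∧ 0 ≤ w.im) ∨ (z.im ≤ 0 ∧ w.im ≤ 0) := by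
    rcases h with h | h <;> rw [h] <;> simp [le_total]
  rcases h2 with ⟨h3, h4⟩ | ⟨h3, h4⟩
  · exact hu.mono fun v hv => (le_min h3 h4).trans_lt hv.2.1
  · exact hl.mono fun v hv => lt_of_lt_of_le hv.2.2 (max_le h3 h4)

/-- A continuous function that is holomorphic off the real line is entire. -/
theorem differentiable_of_off_real {f : ℂ → ℂ} (hc : Continuous f)
    (hu : DifferentiableOn ℂ f upper) (hl : DifferentiableOn ℂ f lower) : Differentiable ℂ f := by
  -- Morera: a rectangle is cut along the real line. Each part lies on one side, and the integrals
  -- over the common edge cancel.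
  have hcons : Complex.IsConservativeOn f Set.univ := fun z w _ => by
    rw [← add_eq_zero_iff_eq_neg, Complex.wedgeIntegral_add_wedgeIntegral_eq]
    have h1 := integral_boundary_rect_of_edge_on_real hc hu hl (z := z) (w := ⟨w.re, 0⟩) (Or.inr rfl)
    have h2 := integral_boundary_rect_of_edge_on_real hc hu hl (z := ⟨z.re, 0⟩) (w := w) (Or.inl rfl)
    have hi : ∀ a b b' : ℝ, IntervalIntegrable (fun y : ℝ => f (a + y * Complex.I)) volume b b' :=
      fun a b b' => Continuous.intervalIntegrable (by fun_prop) _ _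
    simp only at h1 h2
    rw [← intervalIntegral.integral_add_adjacent_intervals (hi w.re z.im 0) (hi w.re 0 w.im),
      ← intervalIntegral.integral_add_adjacent_intervals (hi z.re z.im 0) (hi z.re 0 w.im),
      smul_add, smul_add]
    linear_combination h1 + h2
  exact differentiableOn_univ.1 ((hcons.isExactOn_univ hc).differentiableOn isOpen_univ)

theorem upper_union_lower_union_real :
    upper ∪ lower ∪ {z : ℂ | z.im = 0} = Set.univ := by
  ext z
  simp only [upper, lower, Set.mem_union, Set.mem_ofPred_eq, Set.mem_univ, iff_true]
  rcases lt_trichotomy z.im 0 with h | h | h <;> simp [h]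

/-- Holomorphic functions on the two half-planes with a common boundary function glue to an
entire function. -/
theorem exists_entire_of_boundary {P Q : ℂ → ℂ} {p : ℝ → ℂ} (hP : DifferentiableOn ℂ P upper)
    (hQ : DifferentiableOn ℂ Q lower) (hp : Continuous p) (hbP : HasBoundary upper P p)
    (hbQ : HasBoundary lower Q p) :
    ∃ E : ℂ → ℂ, Differentiable ℂ E ∧ Set.EqOn E P upper ∧ Set.EqOn E Q lower := by
  set E : ℂ → ℂ := fun z => if 0 < z.im then P z else if z.im < 0 then Q z else p z.re with hE
  have hEP : Set.EqOn E P upper := fun z hz => if_pos hz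
  have hEQ : Set.EqOn E Q lower := fun z hz => by
    have hz' : z.im < 0 := hz
    simp [hE, hz', hz'.le.not_gt]
  have hEp : Set.EqOn E (fun z => p z.re) {z : ℂ | z.im = 0} := fun z hz => by
    have hz' : z.im = 0 := hz
    simp [hE, hz']
  have hu := hP.congr hEP
  have hl := hQ.congr hEQ
  have hc : Continuous E := by
    refine continuous_iff_continuousAt.2 fun z => ?_
    rcases lt_trichotomy z.im 0 with h | h | h
    · exact (hl.differentiableAt (isOpen_lower.mem_nhds h)).continuousAt
    · obtain ⟨x, rfl⟩ : ∃ x : ℝ, (x : ℂ) = z := ⟨z.re, Complex.ext (by simp) (by simp [h])⟩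
      have hx : E x = p x := by simpa using hEp h
      rw [ContinuousAt, hx, ← nhdsWithin_univ, ← upper_union_lower_union_real, nhdsWithin_union,
        nhdsWithin_union]
      refine Tendsto.sup (Tendsto.sup ?_ ?_) ?_
      · exact (hbP x).congr' (eventually_mem_nhdsWithin.mono fun z hz => (hEP hz).symm)
      · exact (hbQ x).congr' (eventually_mem_nhdsWithin.mono fun z hz => (hEQ hz).symm)
      · have h3 : Tendsto (fun z : ℂ => p z.re) (𝓝 (x : ℂ)) (𝓝 (p x)) :=
          (hp.comp Complex.continuous_re).tendsto (x : ℂ)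
        exact (h3.mono_left nhdsWithin_le_nhds).congr'
          (eventually_mem_nhdsWithin.mono fun z hz => (hEp hz).symm)
    · exact (hu.differentiableAt (isOpen_upper.mem_nhds h)).continuousAt
  exact ⟨E, differentiable_of_off_real hc hu hl, hEP, hEQ⟩

theorem entire_eq_zero_of_eqOn {E : ℂ → ℂ} (hE : Differentiable ℂ E) {S : Set ℂ} (hS : IsOpen S)
    {a : ℂ} (ha : a ∈ S) (h : ∀ z ∈ S, E z = 0) (z : ℂ) : E z = 0 := by
  have hA : AnalyticOnNhd ℂ E Set.univ := fun z _ => hE.analyticAt z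
  have := hA.eq_of_eventuallyEq (g := 0) (fun z _ => analyticAt_const) (z₀ := a)
    (by filter_upwards [hS.mem_nhds ha] with z hz using h z hz)
  rw [this, Pi.zero_apply]

/-- Gluing with `0` below gives an entire function that vanishes on an open set. -/
theorem eq_zero_of_boundary_zero_upper {D : ℂ → ℂ} (hD : DifferentiableOn ℂ D upper)
    (hb : HasBoundary upper D fun _ => 0) {z : ℂ} (hz : 0 < z.im) : D z = 0 := by
  obtain ⟨E, hE, h1, h2⟩ := exists_entire_of_boundary (Q := fun _ => 0) hD
    (differentiableOn_const 0) continuous_const hb fun _ => tendsto_const_nhds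
  rw [← h1 hz]
  exact entire_eq_zero_of_eqOn hE isOpen_lower (a := -Complex.I) (by simp [lower]) h2 z

theorem eq_zero_of_boundary_zero_lower {D : ℂ → ℂ} (hD : DifferentiableOn ℂ D lower)
    (hb : HasBoundary lower D fun _ => 0) {z : ℂ} (hz : z.im < 0) : D z = 0 := by
  obtain ⟨E, hE, h1, h2⟩ := exists_entire_of_boundary (P := fun _ => 0)
    (differentiableOn_const 0) hD continuous_const (fun _ => tendsto_const_nhds) hb
  rw [← h2 hz]
  exact entire_eq_zero_of_eqOn hE isOpen_upper (a := Complex.I) (by simp [upper]) h1 z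

theorem differentiableOn_cauchy_upper {f : ℝ → ℂ} (hf : MemLp f 2) :
    DifferentiableOn ℂ (cauchy f) upper :=
  fun _ hz => (differentiableAt_cauchy hf (ne_of_gt hz)).differentiableWithinAt

theorem differentiableOn_cauchy_lower {f : ℝ → ℂ} (hf : MemLp f 2) :
    DifferentiableOn ℂ (cauchy f) lower :=
  fun _ hz => (differentiableAt_cauchy hf (ne_of_lt hz)).differentiableWithinAt

theorem tendsto_cauchy_upper {f : ℝ → ℂ} (hf : MemL2Holder f) :
    Tendsto (cauchy f) (Bornology.cobounded ℂ ⊓ 𝓟 upper) (𝓝 0) := by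
  obtain ⟨-, -, -, A, r, h0, h1, hH⟩ := hf.exists_holder
  refine Metric.nhds_basis_closedBall.tendsto_right_iff.2 fun ε hε => ?_
  obtain ⟨R, hR⟩ := cauchy_small_upper hf.1 h0 h1 hH hε
  refine eventually_inf_principal.2 ?_
  filter_upwards [(hasBasis_cobounded_norm (E := ℂ)).mem_of_mem (i := R) trivial] with z hz hz2
  simpa using hR z hz2 hz

theorem tendsto_cauchy_lower {f : ℝ → ℂ} (hf : MemL2Holder f) :
    Tendsto (cauchy f) (Bornology.cobounded ℂ ⊓ 𝓟 lower) (𝓝 0) := by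
  obtain ⟨-, -, -, A, r, h0, h1, hH⟩ := hf.exists_holder
  refine Metric.nhds_basis_closedBall.tendsto_right_iff.2 fun ε hε => ?_
  obtain ⟨R, hR⟩ := cauchy_small_lower hf.1 h0 h1 hH hε
  refine eventually_inf_principal.2 ?_
  filter_upwards [(hasBasis_cobounded_norm (E := ℂ)).mem_of_mem (i := R) trivial] with z hz hz2
  simpa using hR z hz2 hz

/-- Below the line the Cauchy integral is zero, so the lower boundary function `g - c` of the
splitting vanishes. -/
theorem MemPlus.hasBoundary {g : ℝ → ℂ} (hg : MemPlus g) : HasBoundary upper (cauchy g) g := by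
  obtain ⟨hg, h⟩ := memPlus_iff.1 hg
  obtain ⟨-, -, -, A, r, h0, h1, hH⟩ := hg.exists_holder
  obtain ⟨c, C, M, hu, hl, -⟩ := exists_additive_splitting hg.1 h0 h1 hH
  have hc : c = g := by
    ext x
    have := neBot_lower x
    have h2 : Tendsto (fun z => -cauchy g z) (𝓝[lower] (x : ℂ)) (𝓝 0) :=
      tendsto_const_nhds.congr' (eventually_mem_nhdsWithin.mono fun z hz => by
        simp only [h z hz, neg_zero])
    exact (sub_eq_zero.1 (tendsto_nhds_unique (hl x) h2)).symm
  rwa [hc] at hu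

theorem MemMinus.hasBoundary {g : ℝ → ℂ} (hg : MemMinus g) :
    HasBoundary lower (fun z => -cauchy g z) g := by
  obtain ⟨hg, h⟩ := memMinus_iff.1 hg
  obtain ⟨-, -, -, A, r, h0, h1, hH⟩ := hg.exists_holder
  obtain ⟨c, C, M, hu, hl, -⟩ := exists_additive_splitting hg.1 h0 h1 hH
  have hc : ∀ x, c x = 0 := fun x => by
    have := neBot_upper x
    have h2 : Tendsto (cauchy g) (𝓝[upper] (x : ℂ)) (𝓝 0) :=
      tendsto_const_nhds.congr' (eventually_mem_nhdsWithin.mono fun z hz => (h z hz).symm)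
    exact tendsto_nhds_unique (hu x) h2
  simpa only [hc, sub_zero] using hl

/-- Both sides have the same boundary function. This transfers decay at infinity from the Cauchy
integral to `P`. -/
theorem eq_one_add_cauchy_of_plus {P : ℂ → ℂ} {p : ℝ → ℂ} (hP : DifferentiableOn ℂ P upper)
    (hb : HasBoundary upper P p) (hp : MemPlus fun x => p x - 1) {z : ℂ} (hz : 0 < z.im) :
    P z = 1 + cauchy (fun x => p x - 1) z := by
  have h := eq_zero_of_boundary_zero_upper
    (D := fun z => P z - 1 - cauchy (fun x => p x - 1) z)
    ((hP.sub_const 1).sub (differentiableOn_cauchy_upper hp.1.1)) (fun x => ?_) hz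
  · linear_combination h
  · simpa using ((hb x).sub_const 1).sub (hp.hasBoundary x)

theorem eq_one_sub_cauchy_of_minus {Q : ℂ → ℂ} {q : ℝ → ℂ} (hQ : DifferentiableOn ℂ Q lower)
    (hb : HasBoundary lower Q q) (hq : MemMinus fun x => q x - 1) {z : ℂ} (hz : z.im < 0) :
    Q z = 1 - cauchy (fun x => q x - 1) z := by
  have h := eq_zero_of_boundary_zero_lower
    (D := fun z => Q z - 1 + cauchy (fun x => q x - 1) z)
    ((hQ.sub_const 1).add (differentiableOn_cauchy_lower hq.1.1)) (fun x => ?_) hz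
  · linear_combination h
  · simpa using ((hb x).sub_const 1).sub (hq.hasBoundary x)

theorem dense_upper_union_lower : Dense (upper ∪ lower) := fun z => by
  rcases lt_trichotomy z.im 0 with h | h | h
  · exact subset_closure (Or.inr h)
  · obtain ⟨x, rfl⟩ : ∃ x : ℝ, (x : ℂ) = z := ⟨z.re, Complex.ext (by simp) (by simp [h])⟩
    exact closure_mono Set.subset_union_left (mem_closure_iff_nhdsWithin_neBot.2 (neBot_upper x))
  · exact subset_closure (Or.inl h)

/-- An entire function that tends to `a` at infinity off the real line is constant. -/
theorem entire_eq_const {E : ℂ → ℂ} (hE : Differentiable ℂ E) {a : ℂ}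
    (hu : Tendsto E (Bornology.cobounded ℂ ⊓ 𝓟 upper) (𝓝 a))
    (hl : Tendsto E (Bornology.cobounded ℂ ⊓ 𝓟 lower) (𝓝 a)) (z : ℂ) : E z = a := by
  refine hE.apply_eq_of_tendsto_cocompact z ?_
  rw [← Metric.cobounded_eq_cocompact]
  have h : Tendsto E (Bornology.cobounded ℂ ⊓ 𝓟 (upper ∪ lower)) (𝓝 a) := by
    rw [← sup_principal, inf_sup_left]
    exact hu.sup hl
  refine Metric.nhds_basis_closedBall.tendsto_right_iff.2 fun ε hε => ?_
  have h2 := eventually_inf_principal.1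
    (Metric.nhds_basis_closedBall.tendsto_right_iff.1 h ε hε)
  obtain ⟨R, -, hR⟩ := (hasBasis_cobounded_norm (E := ℂ)).eventually_iff.1 h2
  -- Points of the real line are reached by density. The margin in `R + 1` leaves room for the open
  -- condition `R < ‖v‖`.
  filter_upwards [(hasBasis_cobounded_norm (E := ℂ)).mem_of_mem (i := R + 1) trivial] with w hw
  have ho : IsOpen {v : ℂ | R < ‖v‖} := isOpen_lt continuous_const continuous_norm
  have hw2 : w ∈ closure ({v : ℂ | R < ‖v‖} ∩ (upper ∪ lower)) :=
    dense_upper_union_lower.open_subset_closure_inter ho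
      (show R < ‖w‖ by have : R + 1 ≤ ‖w‖ := hw; linarith)
  have hcl : IsClosed (E ⁻¹' Metric.closedBall a ε) :=
    Metric.isClosed_closedBall.preimage hE.continuous
  exact hcl.closure_subset_iff.2 (fun v hv => hR (le_of_lt (show R < ‖v‖ from hv.1)) hv.2) hw2

theorem MemL2Holder.continuous_of_sub_one {p : ℝ → ℂ} (hp : MemL2Holder fun x => p x - 1) :
    Continuous p := by
  simpa using hp.exists_holder.1.add_const 1

/-! ### Uniqueness and existence for `exp L`. -/

/-- Uniqueness of the factorisation of `exp L`. -/
theorem IsFactorisation.eq_exp_cauchy {L : ℝ → ℂ} (hL : MemL2Holder L) {K : ℝ → ℂ}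
    (hK : ∀ x, Complex.exp (L x) = K x) {P Q : ℂ → ℂ} (h : IsFactorisation K P Q) :
    (∀ z : ℂ, 0 < z.im → P z = Complex.exp (cauchy L z)) ∧
      ∀ z : ℂ, z.im < 0 → Q z = Complex.exp (-cauchy L z) := by
  obtain ⟨p, q, hbp, hbq, hp, hq, hpq⟩ := h.boundary
  obtain ⟨-, -, -, A, r, h0, h1, hH⟩ := hL.exists_holder
  obtain ⟨c, C, M, hu, hl, hcH, -, hcL, -⟩ := exists_additive_splitting hL.1 h0 h1 hH
  have hc := (memL2Holder_of hcL h0 h1.le hcH).exists_holder.1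
  have hPd := h.analytic_plus.differentiableOn
  have hQd := h.analytic_minus.differentiableOn
  have hq0 : ∀ x, q x ≠ 0 := fun x hx => by
    have := hpq x
    rw [hx, mul_zero, ← hK] at this
    exact Complex.exp_ne_zero _ this
  obtain ⟨E, hE, hEP, hEQ⟩ := exists_entire_of_boundary
    (P := fun z => P z * Complex.exp (-cauchy L z)) (Q := fun z => Complex.exp (-cauchy L z) / Q z)
    (p := fun x => p x * Complex.exp (-c x))
    (hPd.mul (differentiableOn_cauchy_upper hL.1).neg.cexp)
    ((differentiableOn_cauchy_lower hL.1).neg.cexp.div hQd h.ne_zero_minus)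
    (hp.1.continuous_of_sub_one.mul (by fun_prop))
    (fun x => (hbp x).mul (hu x).neg.cexp)
    (fun x => by
      have h2 := (hl x).cexp.div (hbq x) (hq0 x)
      -- The two boundary functions agree because `p x * q x = exp (L x)`.
      have h3 : p x * Complex.exp (-c x) = Complex.exp (L x - c x) / q x := by
        rw [eq_div_iff (hq0 x), sub_eq_add_neg, Complex.exp_add, hK, hpq]
        ring
      simp only [h3]
      exact h2)
  have hone : ∀ z, E z = 1 := by
    refine entire_eq_const hE ?_ ?_
    · have t1 := tendsto_cauchy_upper hp.1
      have t2 := (tendsto_cauchy_upper hL).neg.cexp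
      have t3 := (t1.const_add 1).mul t2
      rw [neg_zero, Complex.exp_zero, add_zero, mul_one] at t3
      refine t3.congr' (eventually_inf_principal.2 (Eventually.of_forall fun z hz => ?_))
      simp only [hEP hz]
      rw [eq_one_add_cauchy_of_plus hPd hbp hp hz]
    · have t1 := tendsto_cauchy_lower hq.1
      have t2 := (tendsto_cauchy_lower hL).neg.cexp
      have t3 := t2.div (t1.const_sub 1) (by simp)
      rw [neg_zero, Complex.exp_zero, sub_zero, div_one] at t3
      refine t3.congr' (eventually_inf_principal.2 (Eventually.of_forall fun z hz => ?_))
      simp only [hEQ hz, Pi.div_apply]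
      rw [eq_one_sub_cauchy_of_minus hQd hbq hq hz]
  constructor
  · intro z hz
    have h2 := hEP hz
    simp only [hone, Complex.exp_neg] at h2
    rw [eq_comm, mul_inv_eq_one₀ (Complex.exp_ne_zero _)] at h2
    exact h2
  · intro z hz
    have h2 := hEQ hz
    simp only [hone] at h2
    rw [eq_comm, div_eq_one_iff_eq (h.ne_zero_minus z hz)] at h2
    exact h2.symm

/-- Existence of the factorisation of `exp L`. -/
theorem isFactorisation_exp {L : ℝ → ℂ} (hL : MemL2Holder L) {K : ℝ → ℂ}
    (hK : ∀ x, Complex.exp (L x) = K x) {P Q : ℂ → ℂ}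
    (hP : ∀ z : ℂ, 0 < z.im → P z = Complex.exp (cauchy L z))
    (hQ : ∀ z : ℂ, z.im < 0 → Q z = Complex.exp (-cauchy L z)) : IsFactorisation K P Q := by
  obtain ⟨-, -, ⟨M', hM'⟩, A, r, h0, h1, hH⟩ := hL.exists_holder
  obtain ⟨c, C, M, hu, hl, hcH, hcM, hcL, hc0, hd0⟩ := exists_additive_splitting hL.1 h0 h1 hH
  have hdM : ∀ x, ‖L x - c x‖ ≤ M' + M := fun x => (norm_sub_le _ _).trans
    (add_le_add (hM' x) (hcM x))
  have hdL : MemLp (fun x => L x - c x) 2 := hL.1.sub hcL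
  have hdH : ∀ x y, ‖(L x - c x) - (L y - c y)‖ ≤ (A + C) * |x - y| ^ r := fun x y => by
    rw [sub_sub_sub_comm, add_mul]
    exact (norm_sub_le _ _).trans (add_le_add (hH x y) (hcH x y))
  refine ⟨?_, ?_, fun z hz => ?_, fun z hz => ?_, fun x => Complex.exp (c x),
    fun x => Complex.exp (L x - c x), fun x => ?_, fun x => ?_, memPlus_iff.2 ⟨?_, fun z hz => ?_⟩,
    memMinus_iff.2 ⟨?_, fun z hz => ?_⟩, fun x => ?_⟩
  · exact ((differentiableOn_cauchy_upper hL.1).cexp.congr hP).analyticOnNhd isOpen_upper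
  · exact ((differentiableOn_cauchy_lower hL.1).neg.cexp.congr hQ).analyticOnNhd isOpen_lower
  · rw [hP z hz]; exact Complex.exp_ne_zero _
  · rw [hQ z hz]; exact Complex.exp_ne_zero _
  · exact (hu x).cexp.congr' (eventually_mem_nhdsWithin.mono fun z hz => (hP z hz).symm)
  · exact (hl x).cexp.congr' (eventually_mem_nhdsWithin.mono fun z hz => (hQ z hz).symm)
  · exact memL2Holder_of (memLp_exp_sub_one hcL hcM) h0 h1.le fun x y => by
      rw [sub_sub_sub_cancel_right]; exact exp_holder hcM hcH x y
  · exact cauchy_exp_sub_one_eq_zero hcL hcM (s := -1) (by norm_num)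
      (fun z hz => hc0 z (by linarith)) (by linarith)
  · exact memL2Holder_of (memLp_exp_sub_one hdL hdM) h0 h1.le fun x y => by
      rw [sub_sub_sub_cancel_right]; exact exp_holder hdM hdH x y
  · exact cauchy_exp_sub_one_eq_zero hdL hdM (s := 1) (by norm_num)
      (fun z hz => hd0 z (by linarith)) (by linarith)
  · rw [← Complex.exp_add, add_sub_cancel, hK]

/-! ### The logarithm of `K`. -/

/-- Index zero gives the argument a common limit `a` at both ends, and `K → 1` forces `exp (i a) =
1`. Subtracting `a` therefore keeps a branch of the logarithm and makes it vanish at infinity. -/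
theorem exists_isLn {K : ℝ → ℂ} (hK0 : ∀ x, K x ≠ 0) (hK : MemL2Holder fun x => K x - 1)
    (hind : HasIndex K 0) : ∃ L, IsLn K L := by
  obtain ⟨θ, hθ, hKθ, a, b, ha, hb, hab⟩ := hind
  have hab' : a = b := by
    have h2 : (2 * Real.pi) ≠ 0 := by positivity
    rw [eq_comm, div_eq_zero_iff] at hab
    linarith [hab.resolve_right h2]
  subst hab'
  have hc : Continuous K := hK.continuous_of_sub_one
  have ht : Tendsto K (cocompact ℝ) (𝓝 1) := by
    simpa using hK.exists_holder.2.1.add_const 1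
  rw [cocompact_eq_atBot_atTop, tendsto_sup] at ht
  have hdir : ∀ x, Complex.exp (Complex.I * θ x) = K x / (‖K x‖ : ℂ) := fun x => by
    have h0 : (‖K x‖ : ℂ) ≠ 0 := by simpa using hK0 x
    rw [eq_div_iff h0, mul_comm]
    exact (hKθ x).symm
  have hea : Complex.exp (Complex.I * a) = 1 := by
    have t1 : Tendsto (fun x => Complex.exp (Complex.I * θ x)) atTop
        (𝓝 (Complex.exp (Complex.I * a))) :=
      ((Complex.continuous_ofReal.tendsto a).comp ha).const_mul _ |>.cexp
    have t2 : Tendsto (fun x => K x / (‖K x‖ : ℂ)) atTop (𝓝 (1 / ((‖(1 : ℂ)‖ : ℝ) : ℂ))) :=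
      ht.2.div ((Complex.continuous_ofReal.tendsto _).comp ht.2.norm) (by simp)
    simp_rw [hdir] at t1
    simpa using tendsto_nhds_unique t1 t2
  have hlim : ∀ l : Filter ℝ, Tendsto K l (𝓝 1) → Tendsto θ l (𝓝 a) →
      Tendsto (fun x => (Real.log ‖K x‖ : ℂ) + Complex.I * (θ x - a)) l (𝓝 0) := by
    intro l h1 h2
    have t1 := (Complex.continuous_ofReal.tendsto _).comp (h1.norm.log (by simp))
    have t2 := (((Complex.continuous_ofReal.tendsto a).comp h2).sub_const (a : ℂ)).const_mul
      Complex.I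
    simpa using t1.add t2
  refine ⟨fun x => (Real.log ‖K x‖ : ℂ) + Complex.I * (θ x - a), ?_, fun x => ?_,
    hlim _ ht.2 ha, hlim _ ht.1 hb⟩
  · have : Continuous fun x => Real.log ‖K x‖ := hc.norm.log fun x => by simpa using hK0 x
    fun_prop
  · have h0 : 0 < ‖K x‖ := norm_pos_iff.2 (hK0 x)
    rw [Complex.exp_add, mul_sub, Complex.exp_sub, hea, div_one, ← Complex.ofReal_exp,
      Real.exp_log h0]
    exact (hKθ x).symm

/-- The norm of the difference divided by `2π` is continuous, integer-valued and tends to zero; if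
it were nonzero somewhere, it would take the value `1 / 2`. -/
theorem IsLn.unique {K L L' : ℝ → ℂ} (h : IsLn K L) (h' : IsLn K L') : L' = L := by
  obtain ⟨hc, he, ht, -⟩ := h
  obtain ⟨hc', he', ht', -⟩ := h'
  set d : ℝ → ℝ := fun x => ‖L' x - L x‖ / (2 * Real.pi) with hd
  have hpi := Real.pi_pos
  have hint : ∀ x, ∃ n : ℤ, d x = n := fun x => by
    have : Complex.exp (L' x - L x) = 1 := by
      rw [Complex.exp_sub, he, he', div_self]
      rw [← he]; exact Complex.exp_ne_zero _
    obtain ⟨n, hn⟩ := Complex.exp_eq_one_iff.1 this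
    refine ⟨|n|, ?_⟩
    simp only [hd, hn]
    rw [norm_mul, Complex.norm_intCast]
    simp [abs_of_pos hpi]
  have hdt : Tendsto d atTop (𝓝 0) := by
    simpa using ((ht'.sub ht).norm.div_const (2 * Real.pi))
  obtain ⟨x₁, hx₁⟩ := (hdt.eventually_le_const (show (0 : ℝ) < 1 / 2 by norm_num)).exists
  ext x
  by_contra hne
  have hpos : 0 < d x := div_pos (norm_pos_iff.2 (sub_ne_zero.2 hne)) (by positivity)
  have hge : 1 / 2 ≤ d x := by
    obtain ⟨n, hn⟩ := hint x
    rw [hn] at hpos ⊢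
    have : (1 : ℤ) ≤ n := by exact_mod_cast hpos
    have : (1 : ℝ) ≤ n := by exact_mod_cast this
    linarith
  obtain ⟨y, hy⟩ := mem_range_of_exists_le_of_exists_ge
    (show Continuous d by fun_prop) ⟨x₁, hx₁⟩ ⟨x, hge⟩
  obtain ⟨n, hn⟩ := hint y
  rw [hn] at hy
  have h2 : (2 * n : ℝ) = 1 := by linarith
  have h3 : 2 * n = 1 := by exact_mod_cast h2
  omega

/-- The Taylor remainder is at most `‖w‖² ≤ ‖w‖ / 2`. -/
theorem norm_le_two_mul_norm_exp_sub_one {w : ℂ} (hw : ‖w‖ ≤ 1 / 2) :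
    ‖w‖ ≤ 2 * ‖Complex.exp w - 1‖ := by
  have h1 := Complex.norm_exp_sub_one_sub_id_le (x := w) (by linarith)
  have h2 := norm_sub_norm_le w (w - (Complex.exp w - 1))
  rw [sub_sub_cancel, norm_sub_rev w] at h2
  nlinarith [norm_nonneg w]

theorem IsLn.memL2Holder {K L : ℝ → ℂ} (hK : MemL2Holder fun x => K x - 1) (h : IsLn K L) :
    MemL2Holder L := by
  obtain ⟨hc, he, ht, hb⟩ := h
  have hco : Tendsto L (cocompact ℝ) (𝓝 0) := by
    rw [cocompact_eq_atBot_atTop]; exact hb.sup ht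
  obtain ⟨M, hM⟩ : ∃ M, ∀ x, ‖L x‖ ≤ M := by
    have := ZeroAtInftyContinuousMap.isBounded_range (⟨⟨L, hc⟩, hco⟩ : ZeroAtInftyContinuousMap ℝ ℂ)
    obtain ⟨M, hM⟩ := this.exists_norm_le
    exact ⟨M, fun x => hM _ ⟨x, rfl⟩⟩
  have hM0 : 0 ≤ M := (norm_nonneg _).trans (hM 0)
  obtain ⟨-, -, -, A, r, h0, h1, hH⟩ := hK.exists_holder
  have hA := holder_const_nonneg hH
  -- Outside a bounded interval `L` is small and bounded by `2 * ‖K - 1‖`; inside, the constant `M`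
  -- suffices.
  have hL2 : MemLp L 2 := by
    have hev : ∀ᶠ x in cocompact ℝ, ‖L x‖ ≤ 1 / 2 := by
      have := hco.norm
      rw [norm_zero] at this
      exact this.eventually_le_const (by norm_num)
    rw [← Metric.cobounded_eq_cocompact, (hasBasis_cobounded_norm (E := ℝ)).eventually_iff] at hev
    obtain ⟨R, -, hR⟩ := hev
    have hi : MemLp ((Set.Icc (-R) R).indicator fun _ => M) 2 (volume : Measure ℝ) :=
      memLp_indicator_const 2 measurableSet_Icc M (Or.inr (by simp))
    refine ((hK.1.norm.const_mul 2).add hi).mono' hc.aestronglyMeasurable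
      (Eventually.of_forall fun x => ?_)
    simp only [Pi.add_apply]
    by_cases hx : x ∈ Set.Icc (-R) R
    · rw [Set.indicator_of_mem hx]
      have := norm_nonneg (K x - 1)
      linarith [hM x]
    · rw [Set.indicator_of_notMem hx, add_zero, ← he]
      refine norm_le_two_mul_norm_exp_sub_one (hR ?_)
      by_contra h3
      refine hx (abs_le.1 ?_)
      rw [← Real.norm_eq_abs]
      exact le_of_not_ge h3
  have huc := hc.uniformContinuous_of_tendsto_cocompact hco
  obtain ⟨δ, hδ, hδ'⟩ := Metric.uniformContinuous_iff.1 huc (1 / 2) (by norm_num)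
  -- Below distance `δ`, `L x - L y` is at most twice `exp (L x - L y) - 1 = (K x - K y) * exp (-L
  -- y)` in norm. Beyond `δ` the bound `2 * M` is enough.
  refine memL2Holder_of (C := 2 * Real.exp M * A + 2 * M / δ ^ r) (r := r) hL2 h0 h1.le fun x y => ?_
  have hδr := Real.rpow_pos_of_pos hδ r
  rw [add_mul]
  have hp : 0 ≤ |x - y| ^ r := by positivity
  rcases lt_or_ge |x - y| δ with hxy | hxy
  · have h2 := hδ' (a := x) (b := y) (by rwa [Real.dist_eq])
    rw [dist_eq_norm] at h2
    have h3 := norm_le_two_mul_norm_exp_sub_one h2.le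
    have h4 : Complex.exp (L x - L y) - 1 = (K x - K y) * Complex.exp (-L y) := by
      rw [← he, ← he, sub_mul, ← Complex.exp_add, ← Complex.exp_add, add_neg_cancel,
        Complex.exp_zero, sub_eq_add_neg (L x)]
    have h5 : ‖Complex.exp (-L y)‖ ≤ Real.exp M := by
      rw [Complex.norm_exp]
      refine Real.exp_le_exp.2 ((Complex.re_le_norm _).trans ?_)
      rw [norm_neg]; exact hM y
    have h6 : ‖K x - K y‖ ≤ A * |x - y| ^ r := by simpa using hH x y
    rw [h4, norm_mul] at h3
    have h7 : ‖K x - K y‖ * ‖Complex.exp (-L y)‖ ≤ (A * |x - y| ^ r) * Real.exp M := by gcongr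
    have h8 : 0 ≤ 2 * M / δ ^ r * |x - y| ^ r := by positivity
    linarith
  · have h2 : ‖L x - L y‖ ≤ 2 * M := (norm_sub_le _ _).trans (by linarith [hM x, hM y])
    have h3 : δ ^ r ≤ |x - y| ^ r := by gcongr
    have h4 : 2 * M ≤ 2 * M / δ ^ r * |x - y| ^ r := by
      rw [div_mul_eq_mul_div, le_div_iff₀ hδr]
      gcongr
    have h5 : 0 ≤ 2 * Real.exp M * A * |x - y| ^ r := by positivity
    linarith

end RiemannHilbert

theorem mainTheorem3 (K : ℝ → ℂ) (hK0 : ∀ x, K x ≠ 0)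
    (hK : RiemannHilbert.MemL2Holder (fun x => K x - 1)) (hind : RiemannHilbert.HasIndex K 0) :
    ∃ L : ℝ → ℂ, RiemannHilbert.IsLn K L ∧ (∀ L', RiemannHilbert.IsLn K L' → L' = L) ∧
      ∃ hL : MemLp L 2 volume,
        (∀ z : ℂ, 0 < z.im → IntegrableOn (fun t : ℝ =>
          RiemannHilbert.invFourier L hL t * Complex.exp (Complex.I * z * (t : ℂ))) (Set.Ioi 0)) ∧
        (∀ z : ℂ, z.im < 0 → IntegrableOn (fun t : ℝ =>
          RiemannHilbert.invFourier L hL t * Complex.exp (Complex.I * z * (t : ℂ))) (Set.Iio 0)) ∧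
        RiemannHilbert.IsFactorisation K
          (RiemannHilbert.factorPlus (RiemannHilbert.invFourier L hL))
          (RiemannHilbert.factorMinus (RiemannHilbert.invFourier L hL)) ∧
        ∀ P Q : ℂ → ℂ, RiemannHilbert.IsFactorisation K P Q →
          (∀ z : ℂ, 0 < z.im →
            P z = RiemannHilbert.factorPlus (RiemannHilbert.invFourier L hL) z) ∧
          (∀ z : ℂ, z.im < 0 →
            Q z = RiemannHilbert.factorMinus (RiemannHilbert.invFourier L hL) z) := by
  obtain ⟨L, hL⟩ := RiemannHilbert.exists_isLn hK0 hK hind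
  have hm := hL.memL2Holder hK
  refine ⟨L, hL, fun L' hL' => hL.unique hL', hm.1,
    fun z hz => RiemannHilbert.integrableOn_invFourier_pos hm.1 hz,
    fun z hz => RiemannHilbert.integrableOn_invFourier_neg hm.1 hz,
    RiemannHilbert.isFactorisation_exp hm hL.2.1
      (fun z hz => RiemannHilbert.factorPlus_eq hm.1 hz)
      (fun z hz => RiemannHilbert.factorMinus_eq hm.1 hz), fun P Q hPQ => ?_⟩
  obtain ⟨h1, h2⟩ := hPQ.eq_exp_cauchy hm hL.2.1
  exact ⟨fun z hz => by rw [h1 z hz, RiemannHilbert.factorPlus_eq hm.1 hz],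
    fun z hz => by rw [h2 z hz, RiemannHilbert.factorMinus_eq hm.1 hz]⟩
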